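/- Let $N$ indistinguishable particles, bosons ($\sigma=+1$) or fermions ($\sigma=-1$), enter an $M$-port network with unitary matrix $U\in U(M)$, $|k,\mathrm{in}\rangle=\sum_{l=1}^M U_{kl}|l,\mathrm{out}\rangle$. Fock states are labelled by occupations $\mathbf n=(n_1,\dots,n_M)$ with $\sum_k n_k=N$ (and $n_k\le 1$ for fermions), and $$\langle \mathbf s,\mathrm{out}|\mathbf n,\mathrm{in}\rangle_U=\frac{\mathrm{per}\,U[\mathbf n|\mathbf s]}{\sqrt{\mathbf n!\,\mathbf s!}}\ \text{(bosons)},\qquad \langle \mathbf s,\mathrm{out}|\mathbf n,\mathrm{in}\rangle_U=\det U[\mathbf n|\mathbf s]\ \text{(fermions)},$$ where $\mathbf n!=\prod_k n_k!$ and $U[\mathbf n|\mathbf s]=(U_{k_i l_j})_{i,j=1}^N$, with $k_1\le\dots\le k_N$ and $l_1\le\dots\le l_N$ the ports occupied in $\mathbf n$ and in $\mathbf s$, repeated according to occupation. For an arbitrary input state $\rho=\sum_{\mathbf n,\mathbf m}\rho_{\mathbf n,\mathbf m}|\mathbf n,\mathrm{in}\rangle\langle\mathbf m,\mathrm{in}|$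 (positive semidefinite, of trace one) let $p_U(\mathbf s|\rho)=\sum_{\mathbf n,\mathbf m}\rho_{\mathbf n,\mathbf m}\langle \mathbf s,\mathrm{out}|\mathbf n,\mathrm{in}\rangle_U\overline{\langle \mathbf s,\mathrm{out}|\mathbf m,\mathrm{in}\rangle_U}$ be the probability of the output $\mathbf s$, and let $\langle\cdot\rangle$ be the average over Haar-distributed $U\in U(M)$. Put $$u_\sigma(M,N)=\frac{N!}{\prod_{l=0}^{N-1}(M+\sigma l)}=\frac{N!}{(M\pm N\mp1)\cdots M}.$$ (1) For all Fock labels $\mathbf n,\mathbf m,\mathbf s$: $\big\langle \langle \mathbf s,\mathrm{out}|\mathbf n,\mathrm{in}\rangle_U\overline{\langle \mathbf s,\mathrm{out}|\mathbf m,\mathrm{in}\rangle_U}\big\rangle=\delta_{\mathbf n,\mathbf m}\,u_\sigma(M,N)$. In particular the average output probability of every Fock input is $u_\sigma(M,N)$. For every state $\rho$ the average output probability depends only on the diagonal of $\rho$: $\langle p_U(\mathbf s|\rho)\rangle=\sum_{\mathbf n}\rho_{\mathbf n,\mathbf n}\langle p_U(\mathbf s|\mathbf n)\rangle$, where $p_U(\mathbf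 s|\mathbf n)$ is the output probability for the Fock input $\mathbf n$. Hence $\langle p_U(\mathbf s|\rho)\rangle=u_\sigma(M,N)$. All averages are of integrable functions of $U$. (2) Let the output ports be partitioned into $r$ bins with $K_1,\dots,K_r$ ports, and let $P(\mathbf n|\mathbf K)$ be the average probability, for the input $\rho$, to count $n_i$ particles in the bin $i$ for $i=1,\dots,r$, where $\sum_i n_i=N$. For every state $\rho$, $$P(\mathbf n|\mathbf K)=u_\sigma(M,N)\prod_{i=1}^r\frac{\prod_{l=0}^{n_i-1}(K_i+\sigma l)}{n_i!}.$$ Write $\alpha=N/M$ and $x_i=n_i/N$, and fix $q_1,\dots,q_r>0$, $A>0$ and $0<\epsilon<\frac16$. Consider networks and bins with $K_i/M=q_i$ for all $i$, and the condition $$|n_i-Nq_i|\le A N^{\frac23-\epsilon}\quad\text{for all } i. \tag{$*$}$$ (3) Put $E=N^{-3\epsilon}+\alpha/N$ for bosons and $E=(1-\alpha)^{-3}N^{-3\epsilon}$ for fermions (with $\alpha<1$). For every $B$ there are $C$ and $N_0$, depending only on $\sigma,r,q_1,\dots,q_r,A,\epsilon,B$, such that for all $N,M\ge N_0$ with $E\le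 B$, all states $\rho$, and all $\mathbf n$ with $\sum_i n_i=N$ satisfying $(*)$, $$\left|P(\mathbf n|\mathbf K)-G\right|\le C\,E\,G,\qquad G=\frac{\exp\left\{-N\sum_{i=1}^r\frac{(x_i-q_i)^2}{2(1+\sigma\alpha)q_i}\right\}}{\left(2\pi[1+\sigma\alpha]N\right)^{\frac{r-1}2}\prod_{i=1}^r\sqrt{q_i}}.$$ (4) Fix also $\alpha=N/M>0$ (with $\alpha<1$ for fermions). There are $C$ and $N_0$, depending only on $\sigma,r,q_1,\dots,q_r,A,\epsilon,\alpha$, such that for all $N,M\ge N_0$, all states $\rho$, and all $\mathbf n$ with $\sum_i n_i=N$ violating $(*)$, $$P(\mathbf n|\mathbf K)\le C\,N^{s(\sigma)}\exp\left\{-\frac{A^2}{1+\sigma\alpha}N^{\frac13-2\epsilon}\right\},\qquad s(+1)=\tfrac12,\quad s(-1)=\tfrac52 .$$ -/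

import Mathlib

open MeasureTheory
open scoped ComplexOrder

noncomputable section

/-- The two kinds of indistinguishable identical particles. -/
inductive Statistics
  | boson
  | fermion

/-- The sign `+1` for bosons and `-1` for fermions. -/
def Statistics.sgn : Statistics → ℝ
  | .boson => 1
  | .fermion => -1

/-- Occupation numbers `(n₁, …, n_M)` of `N` particles in `M` ports; for fermions at most one
particle per port. They label the Fock states. -/
def Fock (σ : Statistics) (M N : ℕ) : Type :=
  {n : Fin M → ℕ // ∑ l, n l = N ∧ (σ = Statistics.fermion → ∀ l, n l ≤ 1)}

namespace Fock

variable {σ : Statistics} {M N : ℕ}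

instance : DecidableEq (Fock σ M N) := Classical.decEq _

instance : Finite (Fock σ M N) :=
  Set.Finite.to_subtype
    ((Finset.finite_toSet (Finset.piAntidiag (Finset.univ : Finset (Fin M)) N)).subset
      (fun n hn => by simpa using hn.1))

instance : Fintype (Fock σ M N) := Fintype.ofFinite _

/-- The multiset of occupied ports, each repeated according to its occupation number. -/
def multiset (n : Fock σ M N) : Multiset (Fin M) := ∑ l, n.1 l • ({l} : Multiset (Fin M))

theorem length_sort_multiset (n : Fock σ M N) : n.multiset.sort.length = N := by
  simp [multiset, n.2.1]

/-- The ports `k₁ ≤ … ≤ k_N` corresponding to the occupations. -/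
def ports (n : Fock σ M N) (i : Fin N) : Fin M :=
  n.multiset.sort.get (Fin.cast n.length_sort_multiset.symm i)

/-- `n! = n₁! ⋯ n_M!`. -/
def fact (n : Fock σ M N) : ℕ := ∏ l, (n.1 l).factorial

end Fock

/-- The permanent for bosons, the determinant for fermions. -/
def perDet (σ : Statistics) {N : ℕ} (A : Matrix (Fin N) (Fin N) ℂ) : ℂ :=
  match σ with
  | .boson => A.permanent
  | .fermion => A.det

/-- The amplitude `⟨s, out | n, in⟩` for the network `|k, in⟩ = ∑ l, U k l |l, out⟩`. For fermions
the normalization is `1`. -/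
def amplitude {σ : Statistics} {M N : ℕ} (U : Matrix (Fin M) (Fin M) ℂ) (n s : Fock σ M N) : ℂ :=
  perDet σ (U.submatrix n.ports s.ports) / (Real.sqrt ((n.fact : ℝ) * (s.fact : ℝ)) : ℂ)

/-- Density matrices in the Fock basis of the `N`-particle space. -/
def IsState {σ : Statistics} {M N : ℕ} (ρ : Matrix (Fock σ M N) (Fock σ M N) ℂ) : Prop :=
  ρ.PosSemidef ∧ ρ.trace = 1

/-- `⟨s, out | ρ | s, out⟩` for `ρ = ∑ n m, ρ n m |n, in⟩⟨m, in|`, as a complex number. -/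
def outExpectation {σ : Statistics} {M N : ℕ} (ρ : Matrix (Fock σ M N) (Fock σ M N) ℂ)
    (U : Matrix (Fin M) (Fin M) ℂ) (s : Fock σ M N) : ℂ :=
  ∑ n, ∑ m, ρ n m * (amplitude U n s * star (amplitude U m s))

/-- For a state this expectation is real and nonnegative, so its real part loses nothing. -/
theorem outExpectation_nonneg {σ : Statistics} {M N : ℕ}
    {ρ : Matrix (Fock σ M N) (Fock σ M N) ℂ} (hρ : ρ.PosSemidef)
    (U : Matrix (Fin M) (Fin M) ℂ) (s : Fock σ M N) : 0 ≤ outExpectation ρ U s := by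
  have h := hρ.dotProduct_mulVec_nonneg (fun m => star (amplitude U m s))
  refine h.trans_eq ?_
  simp only [outExpectation, dotProduct, Matrix.mulVec, Finset.mul_sum, Pi.star_apply, star_star]
  refine Finset.sum_congr rfl fun n _ => Finset.sum_congr rfl fun m _ => by ring

/-- The probability of the output occupations `s`, for the input state `ρ` and the network `U`. -/
def outProb {σ : Statistics} {M N : ℕ} (ρ : Matrix (Fock σ M N) (Fock σ M N) ℂ)
    (U : Matrix (Fin M) (Fin M) ℂ) (s : Fock σ M N) : ℝ :=
  (outExpectation ρ U s).re

/-- The number of output ports in bin `i`, where `b l` is the bin of the port `l`. -/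
def binSize {M r : ℕ} (b : Fin M → Fin r) (i : Fin r) : ℕ :=
  (Finset.univ.filter (fun l => b l = i)).card

open Classical in
/-- The probability to count `n i` particles in the bin `i` for every `i`. -/
def binProb {σ : Statistics} {M N r : ℕ} (ρ : Matrix (Fock σ M N) (Fock σ M N) ℂ)
    (U : Matrix (Fin M) (Fin M) ℂ) (b : Fin M → Fin r) (n : Fin r → ℕ) : ℝ :=
  ∑ s ∈ Finset.univ.filter
      (fun s : Fock σ M N => ∀ i, ∑ l ∈ Finset.univ.filter (fun l => b l = i), s.1 l = n i),
    outProb ρ U s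

instance (M : ℕ) : CompactSpace (Matrix.unitaryGroup (Fin M) ℂ) := by
  refine isCompact_iff_compactSpace.mp ?_
  have hK : IsCompact (Set.pi Set.univ fun _ : Fin M =>
      Set.pi Set.univ fun _ : Fin M => Metric.closedBall (0 : ℂ) 1) :=
    isCompact_univ_pi fun _ => isCompact_univ_pi fun _ => isCompact_closedBall 0 1
  refine IsCompact.of_isClosed_subset hK
    (isClosed_unitary (R := Matrix (Fin M) (Fin M) ℂ)) ?_
  intro U hU i _ j _
  simpa using entry_norm_bound_of_unitary hU i j

instance (M : ℕ) : MeasurableSpace (Matrix.unitaryGroup (Fin M) ℂ) := borel _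

instance (M : ℕ) : BorelSpace (Matrix.unitaryGroup (Fin M) ℂ) := ⟨rfl⟩

/-- The Haar probability measure of the unitary group `U(M)`. -/
def haarU (M : ℕ) : Measure (Matrix.unitaryGroup (Fin M) ℂ) := Measure.haarMeasure ⊤

instance (M : ℕ) : IsProbabilityMeasure (haarU M) :=
  ⟨by simpa [haarU] using
    Measure.haarMeasure_self (K₀ := (⊤ : TopologicalSpace.PositiveCompacts
      (Matrix.unitaryGroup (Fin M) ℂ)))⟩

/-- The Haar average of the probability of the output occupations `s`. -/
def avgOutProb {σ : Statistics} {M N : ℕ} (ρ : Matrix (Fock σ M N) (Fock σ M N) ℂ)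
    (s : Fock σ M N) : ℝ :=
  ∫ U, outProb ρ U.1 s ∂(haarU M)

/-- The Haar average of the probability of the counts `n` in the bins given by `b`. -/
def avgBinProb {σ : Statistics} {M N r : ℕ} (ρ : Matrix (Fock σ M N) (Fock σ M N) ℂ)
    (b : Fin M → Fin r) (n : Fin r → ℕ) : ℝ :=
  ∫ U, binProb ρ U.1 b n ∂(haarU M)

/-- `N! / ((M ± N ∓ 1) ⋯ M)`, with the product over `M ± l`, `0 ≤ l < N`. -/
def uniformProb (σ : Statistics) (M N : ℕ) : ℝ :=
  (N.factorial : ℝ) / ∏ l ∈ Finset.range N, ((M : ℝ) + σ.sgn * (l : ℝ))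

/-- The particle density. -/
def density (M N : ℕ) : ℝ := (N : ℝ) / (M : ℝ)

/-- The asymptotic Gaussian, with `x i = n i / N` and `α = N / M`. -/
def gaussianLaw (σ : Statistics) (M N : ℕ) {r : ℕ} (q : Fin r → ℝ) (n : Fin r → ℕ) : ℝ :=
  Real.exp (-(N : ℝ) * ∑ i, ((n i : ℝ) / (N : ℝ) - q i) ^ 2 /
      (2 * (1 + σ.sgn * density M N) * q i)) /
    ((2 * Real.pi * (1 + σ.sgn * density M N) * (N : ℝ)) ^ (((r : ℝ) - 1) / 2) *
      ∏ i, Real.sqrt (q i))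

/-- The order of the relative error of the Gaussian law: `N ^ (-3ε) + α / N` for bosons and
`(1 - α)⁻³ N ^ (-3ε)` for fermions. -/
def errorOrder (σ : Statistics) (M N : ℕ) (ε : ℝ) : ℝ :=
  match σ with
  | .boson => 1 / (N : ℝ) ^ (3 * ε) + density M N / (N : ℝ)
  | .fermion => ((1 - density M N) ^ 3)⁻¹ / (N : ℝ) ^ (3 * ε)

/-- The window of counts `|n i - N q i| ≤ A N ^ (2/3 - ε)` for all `i`. -/
def InWindow (N : ℕ) {r : ℕ} (q : Fin r → ℝ) (A ε : ℝ) (n : Fin r → ℕ) : Prop :=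
  ∀ i, |(n i : ℝ) - (N : ℝ) * q i| ≤ A * (N : ℝ) ^ (2 / 3 - ε)

/-- The power `s(σ)` of `N` in the tail bound. -/
def tailPower : Statistics → ℝ
  | .boson => 1 / 2
  | .fermion => 5 / 2

end

/-! The amplitudes are the matrix elements of the representation of `U(M)` on the symmetric or
antisymmetric `N`-th power of `ℂ^M`: the Cauchy–Binet formula, grouped by occupation numbers, is the
composition law `amplitude_mul`. By invariance of Haar measure the averaged operator `avgTransition
s` commutes with this representation. That it is scalar is shown directly, without invoking
irreducibility. Diagonal networks multiply Fock states by phases that separate different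
occupations, so off-diagonal entries vanish (`avgTransition_of_ne`). Commutation then equates two
diagonal entries whenever some network has a nonzero amplitude between the two states
(`avgTransition_diag_eq`). Unitarity makes the diagonal sum to one, so each entry is the inverse
dimension, and counting multisets or subsets of ports identifies it with `uniformProb`. A bin
probability is this constant times the number of Fock states with the given counts, which factorizes
over the bins (`card_binned`).

The rest is analysis of a product of binomial coefficients. Inside the window, Stirling's formula is
applied to each factor and expanded around `n i = q i * N`. The leading terms cancel because the
fractions sum to one, the linear terms because the deviations sum to zero, and the quadratic terms
form the Gaussian exponent. The cubic remainder is of order `N * (N ^ (-1/3 - ε)) ^ 3 = N ^ (-3 *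
ε)`, up to powers of `N / (M ± N)`.

Outside the window Stirling's formula is unavailable for the bins, whose counts may be zero. Each
factor is instead bounded by its generating function at a free parameter. One bin with a large
deviation is tilted towards it and all other bins are tilted oppositely, as if they were a single
bin (`two_bin_exponent_le`). The tilt is fixed at the edge of the window, since any further
deviation only lowers the bound. -/

open scoped Matrix

/-- The character of the symmetric group attached to the statistics: trivial for bosons, the sign
for fermions. -/
noncomputable def Statistics.permChar (σ : Statistics) {N : ℕ} : Equiv.Perm (Fin N) →* ℂ :=
  match σ with
  | .boson => 1
  | .fermion => (Int.castRingHom ℂ).toMonoidHom.comp ((Units.coeHom ℤ).comp Equiv.Perm.sign)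

/-! ### Permanents and determinants in a common form -/

section PerDet

variable {σ : Statistics} {N : ℕ}

theorem Statistics.permChar_mul_self (τ : Equiv.Perm (Fin N)) :
    σ.permChar τ * σ.permChar τ = 1 := by
  cases σ
  · simp [Statistics.permChar]
  · rcases Int.units_eq_one_or (Equiv.Perm.sign τ) with h | h <;> simp [Statistics.permChar, h]

theorem Statistics.star_permChar (τ : Equiv.Perm (Fin N)) :
    star (σ.permChar τ) = σ.permChar τ := by
  cases σ
  · simp [Statistics.permChar]
  · rcases Int.units_eq_one_or (Equiv.Perm.sign τ) with h | h <;> simp [Statistics.permChar, h]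

theorem perDet_eq_sum (A : Matrix (Fin N) (Fin N) ℂ) :
    perDet σ A = ∑ τ : Equiv.Perm (Fin N), σ.permChar τ * ∏ i, A (τ i) i := by
  cases σ
  · simp [perDet, Statistics.permChar, Matrix.permanent]
  · simp [perDet, Statistics.permChar, Matrix.det_apply']

theorem perDet_transpose (A : Matrix (Fin N) (Fin N) ℂ) : perDet σ Aᵀ = perDet σ A := by
  cases σ <;> simp [perDet]

theorem perDet_conjTranspose (A : Matrix (Fin N) (Fin N) ℂ) :
    perDet σ Aᴴ = star (perDet σ A) := by
  have h : Aᴴ = (A.map star)ᵀ := rfl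
  rw [h, perDet_transpose, perDet_eq_sum, perDet_eq_sum, star_sum]
  refine Finset.sum_congr rfl fun τ _ => ?_
  rw [star_mul', Statistics.star_permChar, star_prod]
  rfl

theorem perDet_submatrix_rows (π : Equiv.Perm (Fin N)) (A : Matrix (Fin N) (Fin N) ℂ) :
    perDet σ (A.submatrix π id) = σ.permChar π * perDet σ A := by
  cases σ
  · simp [perDet, Statistics.permChar, Matrix.permanent_permute_cols]
  · simp [perDet, Statistics.permChar, Matrix.det_permute]

theorem perDet_submatrix_cols (π : Equiv.Perm (Fin N)) (A : Matrix (Fin N) (Fin N) ℂ) :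
    perDet σ (A.submatrix id π) = σ.permChar π * perDet σ A := by
  rw [← perDet_transpose, Matrix.transpose_submatrix, perDet_submatrix_rows, perDet_transpose]

variable {ι : Type*}

/-- Multilinearity in the columns of the product; the second factor is not yet symmetrized. -/
theorem perDet_mul_submatrix_eq_sum [Fintype ι] (V U : Matrix ι ι ℂ) (a c : Fin N → ι) :
    perDet σ ((V * U).submatrix a c) =
      ∑ f : Fin N → ι, perDet σ (V.submatrix a f) * ∏ i, U (f i) (c i) := by
  simp only [perDet_eq_sum, Matrix.submatrix_apply, Matrix.mul_apply, Fintype.prod_sum,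
    Finset.mul_sum, Finset.sum_mul, Finset.prod_mul_distrib]
  rw [Finset.sum_comm]
  exact Finset.sum_congr rfl fun f _ => Finset.sum_congr rfl fun τ _ => by ring

/-- The Cauchy–Binet formula for permanents and determinants, as a sum over all selections of
intermediate indices. -/
theorem factorial_mul_perDet_mul_submatrix [Fintype ι] (V U : Matrix ι ι ℂ) (a c : Fin N → ι) :
    (N.factorial : ℂ) * perDet σ ((V * U).submatrix a c) =
      ∑ f : Fin N → ι, perDet σ (V.submatrix a f) * perDet σ (U.submatrix f c) := by
  -- Relabelling the selection `f` by `π` costs the character of `π`. Summing over all `π` then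
  -- assembles the second permanent or determinant, at the price of the factor `N!`.
  have h : ∀ π : Equiv.Perm (Fin N), perDet σ ((V * U).submatrix a c) =
      ∑ f : Fin N → ι, perDet σ (V.submatrix a f) *
        (σ.permChar π * ∏ i, U (f (π i)) (c i)) := by
    intro π
    rw [perDet_mul_submatrix_eq_sum]
    rw [← Equiv.sum_comp (π.arrowCongr (Equiv.refl ι)).symm]
    refine Finset.sum_congr rfl fun f _ => ?_
    have : V.submatrix a ((π.arrowCongr (Equiv.refl ι)).symm f) =
        (V.submatrix a f).submatrix id π := by
      ext i j; simp [Equiv.arrowCongr]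
    rw [this, perDet_submatrix_cols]
    simp [Equiv.arrowCongr]
    ring
  calc (N.factorial : ℂ) * perDet σ ((V * U).submatrix a c)
      = ∑ _π : Equiv.Perm (Fin N), perDet σ ((V * U).submatrix a c) := by
        simp [Fintype.card_perm]
    _ = _ := by
        rw [Finset.sum_congr rfl fun π _ => h π, Finset.sum_comm]
        refine Finset.sum_congr rfl fun f _ => ?_
        rw [← Finset.mul_sum, perDet_eq_sum (U.submatrix f c)]
        rfl

theorem perDet_fermion_submatrix_eq_zero (V : Matrix ι ι ℂ) (a f : Fin N → ι)
    (hf : ¬ Function.Injective f) : perDet .fermion (V.submatrix a f) = 0 := by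
  obtain ⟨i, j, hij, hne⟩ : ∃ i j, f i = f j ∧ i ≠ j := by
    simpa [Function.Injective] using hf
  exact Matrix.det_zero_of_column_eq hne fun k => by simp [hij]

end PerDet

/-! ### Selections of ports and occupation numbers -/

theorem exists_perm_comp_eq {α ι : Type*} [Fintype α] [DecidableEq ι] (f p : α → ι)
    (h : ∀ l, Fintype.card {i // f i = l} = Fintype.card {i // p i = l}) :
    ∃ π : Equiv.Perm α, p ∘ π = f := by
  let e : ∀ l, {i // f i = l} ≃ {i // p i = l} := fun l => Fintype.equivOfCardEq (h l)
  refine ⟨((Equiv.sigmaFiberEquiv f).symm.trans (Equiv.sigmaCongrRight e)).trans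
    (Equiv.sigmaFiberEquiv p), ?_⟩
  funext i
  exact (e (f i) ⟨i, rfl⟩).2

namespace Fock

variable {σ : Statistics} {M N : ℕ}

@[ext] theorem ext {n m : Fock σ M N} (h : ∀ l, n.1 l = m.1 l) : n = m :=
  Subtype.ext (funext h)

theorem count_multiset (n : Fock σ M N) (l : Fin M) : n.multiset.count l = n.1 l := by
  simp [multiset, Multiset.count_sum', Multiset.count_nsmul, Multiset.count_singleton]

theorem map_ports (n : Fock σ M N) :
    Multiset.map n.ports Finset.univ.val = n.multiset := by
  have h : List.ofFn n.ports = n.multiset.sort := by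
    apply List.ext_get
    · simp [n.length_sort_multiset]
    · intro i h1 h2
      simp [ports]
  rw [← Multiset.sort_eq n.multiset (· ≤ ·), ← h, Fin.univ_val_map]

theorem card_ports_eq (n : Fock σ M N) (l : Fin M) :
    Fintype.card {i // n.ports i = l} = n.1 l := by
  rw [← count_multiset, ← map_ports, Multiset.count_map, Fintype.card_subtype]
  simp [Finset.card, Finset.filter, eq_comm]

theorem card_perm_ports (n : Fock σ M N) :
    Fintype.card {π : Equiv.Perm (Fin N) // n.ports ∘ π = n.ports} = n.fact := by
  rw [DomMulAct.stabilizer_card]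
  simp [fact, card_ports_eq]

theorem fact_ne_zero (n : Fock σ M N) : n.fact ≠ 0 :=
  Finset.prod_ne_zero_iff.mpr fun _ _ => Nat.factorial_ne_zero _

theorem fact_fermion (n : Fock .fermion M N) : n.fact = 1 :=
  Finset.prod_eq_one fun l _ => Nat.factorial_eq_one.mpr (n.2.2 rfl l)

theorem ports_injective (n : Fock .fermion M N) : Function.Injective n.ports := by
  intro i j hij
  have h : Fintype.card {k // n.ports k = n.ports j} ≤ 1 := by
    rw [card_ports_eq]; exact n.2.2 rfl _
  exact congrArg Subtype.val
    ((Fintype.card_le_one_iff_subsingleton.mp h).elim ⟨i, hij⟩ ⟨j, rfl⟩)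

theorem prod_ports {R : Type*} [CommMonoid R] (n : Fock σ M N) (d : Fin M → R) :
    ∏ i, d (n.ports i) = ∏ l, d l ^ n.1 l := by
  rw [← Finset.prod_fiberwise_of_maps_to (g := n.ports) (t := Finset.univ) (fun _ _ => by simp)]
  refine Finset.prod_congr rfl fun l _ => ?_
  rw [Finset.prod_congr rfl (g := fun _ => d l) (fun i hi => by rw [(Finset.mem_filter.mp hi).2]),
    Finset.prod_const, ← card_ports_eq, Fintype.card_subtype]

/-- The occupation numbers of a selection of ports. -/
theorem exists_of_selection (f : Fin N → Fin M)
    (hf : σ = .fermion → Function.Injective f) :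
    ∃ k : Fock σ M N, ∀ l, k.1 l = Fintype.card {i // f i = l} := by
  refine ⟨⟨fun l => Fintype.card {i // f i = l}, ?_, ?_⟩, fun l => rfl⟩
  · rw [← Fintype.card_sigma, Fintype.card_congr (Equiv.sigmaFiberEquiv f), Fintype.card_fin]
  · intro h l
    have := hf h
    refine Fintype.card_le_one_iff_subsingleton.mpr ⟨fun a b => Subtype.ext (this ?_)⟩
    rw [a.2, b.2]

/-- Orbit counting: the permutations of `k.ports` cover the selections with occupations `k`, and
each fibre is a coset of the stabilizer, which has `k!` elements. The invariant `G` is constant on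
this orbit. -/
theorem fact_mul_sum_selection (k : Fock σ M N) (G : (Fin N → Fin M) → ℂ)
    (hG : ∀ f (π : Equiv.Perm (Fin N)), G (f ∘ π) = G f) :
    (k.fact : ℂ) * ∑ f with ∀ l, Fintype.card {i // f i = l} = k.1 l, G f =
      N.factorial * G k.ports := by
  have h1 : ∀ f ∈ Finset.univ.filter
      (fun f : Fin N → Fin M => ∀ l, Fintype.card {i // f i = l} = k.1 l),
      G f = G k.ports := by
    intro f hf
    obtain ⟨π, rfl⟩ := exists_perm_comp_eq f k.ports
      (fun l => by rw [(Finset.mem_filter.mp hf).2 l, card_ports_eq])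
    exact hG _ π
  have h2 : ∀ f ∈ Finset.univ.filter
      (fun f : Fin N → Fin M => ∀ l, Fintype.card {i // f i = l} = k.1 l),
      (Finset.univ.filter fun π : Equiv.Perm (Fin N) => k.ports ∘ π = f).card = k.fact := by
    intro f hf
    obtain ⟨π₀, rfl⟩ := exists_perm_comp_eq f k.ports
      (fun l => by rw [(Finset.mem_filter.mp hf).2 l, card_ports_eq])
    rw [← card_perm_ports, ← Fintype.card_subtype]
    refine Fintype.card_congr ((Equiv.mulRight π₀⁻¹).subtypeEquiv fun π => ?_)
    constructor
    · intro h
      funext i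
      have := congrFun h (π₀⁻¹ i)
      simpa using this
    · intro h
      funext i
      have := congrFun h (π₀ i)
      simpa using this
  have h3 := Finset.card_eq_sum_card_fiberwise
    (f := fun π : Equiv.Perm (Fin N) => k.ports ∘ π) (s := Finset.univ)
    (t := Finset.univ.filter
      (fun f : Fin N → Fin M => ∀ l, Fintype.card {i // f i = l} = k.1 l)) (by
      intro π _
      simp only [Finset.coe_filter, Finset.mem_univ, true_and, Set.mem_ofPred_eq]
      intro l
      rw [← card_ports_eq]
      exact Fintype.card_congr (π.subtypeEquiv fun i => Iff.rfl))
  rw [Finset.sum_congr rfl h2, Finset.sum_const, Finset.card_univ, Fintype.card_perm,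
    Fintype.card_fin, smul_eq_mul] at h3
  rw [Finset.sum_congr rfl h1, Finset.sum_const, nsmul_eq_mul, h3]
  push_cast
  ring

/-- A sum over all selections of ports, grouped by the occupation numbers. -/
theorem sum_selection (G : (Fin N → Fin M) → ℂ)
    (hG : ∀ f (π : Equiv.Perm (Fin N)), G (f ∘ π) = G f)
    (hG' : σ = .fermion → ∀ f, ¬ Function.Injective f → G f = 0) :
    ∑ f, G f = ∑ k : Fock σ M N, (N.factorial : ℂ) / k.fact * G k.ports := by
  have h : ∀ k : Fock σ M N, (N.factorial : ℂ) / k.fact * G k.ports =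
      ∑ f with ∀ l, Fintype.card {i // f i = l} = k.1 l, G f := by
    intro k
    have hk : (k.fact : ℂ) ≠ 0 := by exact_mod_cast k.fact_ne_zero
    rw [div_mul_eq_mul_div, div_eq_iff hk, ← fact_mul_sum_selection k G hG, mul_comm]
  simp only [h, Finset.sum_filter]
  rw [Finset.sum_comm]
  refine Finset.sum_congr rfl fun f _ => ?_
  -- A non-injective selection of fermions belongs to no Fock state, which is why `G` has to vanish
  -- there.
  by_cases hf : σ = .fermion → Function.Injective f
  · obtain ⟨k, hk⟩ := exists_of_selection f hf
    rw [Finset.sum_eq_single k, if_pos fun l => (hk l).symm]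
    · intro k' _ hne
      refine if_neg fun h' => hne (Fock.ext fun l => ?_)
      rw [hk, h' l]
    · simp
  · push Not at hf
    rw [hG' hf.1 f hf.2]
    simp

end Fock

/-! ### Amplitudes as a unitary representation -/

section Amplitude

variable {σ : Statistics} {M N : ℕ}

theorem sqrt_fact_mul_fact (n s : Fock σ M N) :
    ((Real.sqrt ((n.fact : ℝ) * (s.fact : ℝ)) : ℝ) : ℂ) =
      (Real.sqrt n.fact : ℂ) * (Real.sqrt s.fact : ℂ) := by
  rw [Real.sqrt_mul (Nat.cast_nonneg _)]
  push_cast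
  rfl

theorem sqrt_fact_mul_self (n : Fock σ M N) :
    (Real.sqrt n.fact : ℂ) * (Real.sqrt n.fact : ℂ) = n.fact := by
  rw [← Complex.ofReal_mul, Real.mul_self_sqrt (Nat.cast_nonneg _)]
  simp

theorem sqrt_fact_ne_zero (n : Fock σ M N) : (Real.sqrt n.fact : ℂ) ≠ 0 := by
  have h : (0 : ℝ) < n.fact := by exact_mod_cast Nat.pos_of_ne_zero n.fact_ne_zero
  exact_mod_cast (Real.sqrt_pos.mpr h).ne'

/-- Composition of networks. -/
theorem amplitude_mul (V U : Matrix (Fin M) (Fin M) ℂ) (n s : Fock σ M N) :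
    amplitude (V * U) n s = ∑ k, amplitude V n k * amplitude U k s := by
  have hN : (N.factorial : ℂ) ≠ 0 := by exact_mod_cast N.factorial_ne_zero
  -- The `N!` of Cauchy–Binet cancels against the `N! / k!` of the grouping; the remaining `1 / k!`
  -- is the product of the two normalizations `1 / √(k!)` of the intermediate state.
  have h : perDet σ ((V * U).submatrix n.ports s.ports) =
      ∑ k : Fock σ M N, (1 / (k.fact : ℂ)) * (perDet σ (V.submatrix n.ports k.ports) *
        perDet σ (U.submatrix k.ports s.ports)) := by
    refine mul_left_cancel₀ hN ?_
    rw [factorial_mul_perDet_mul_submatrix, Fock.sum_selection (σ := σ), Finset.mul_sum]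
    · exact Finset.sum_congr rfl fun k _ => by ring
    · intro f π
      have h1 : V.submatrix n.ports (f ∘ π) = (V.submatrix n.ports f).submatrix id π := rfl
      have h2 : U.submatrix (f ∘ π) s.ports = (U.submatrix f s.ports).submatrix π id := rfl
      rw [h1, h2, perDet_submatrix_cols, perDet_submatrix_rows]
      linear_combination (perDet σ (V.submatrix n.ports f) *
        perDet σ (U.submatrix f s.ports)) * σ.permChar_mul_self π
    · rintro rfl f hf
      rw [perDet_fermion_submatrix_eq_zero _ _ _ hf, zero_mul]
  simp only [amplitude, h, Finset.sum_div, sqrt_fact_mul_fact]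
  refine Finset.sum_congr rfl fun k _ => ?_
  rw [← sqrt_fact_mul_self k]
  have := sqrt_fact_ne_zero k
  have := sqrt_fact_ne_zero n
  have := sqrt_fact_ne_zero s
  field_simp

/-- Only permutations stabilizing `n.ports` contribute, each with value one, and there are `n!` of
them. For fermions the stabilizer is trivial, so no sign enters. -/
theorem amplitude_one_self (n : Fock σ M N) :
    amplitude (1 : Matrix (Fin M) (Fin M) ℂ) n n = 1 := by
  have hχ : ∀ τ : Equiv.Perm (Fin N), n.ports ∘ τ = n.ports → σ.permChar τ = 1 := by
    cases σ
    · intro τ _; rfl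
    · intro τ hτ
      have : τ = 1 := Equiv.ext fun i => n.ports_injective (congrFun hτ i)
      rw [this, map_one]
  have h : perDet σ ((1 : Matrix (Fin M) (Fin M) ℂ).submatrix n.ports n.ports) = n.fact := by
    rw [perDet_eq_sum, ← n.card_perm_ports, Fintype.card_subtype, Finset.card_eq_sum_ones,
      Nat.cast_sum, Finset.sum_filter]
    refine Finset.sum_congr rfl fun τ _ => ?_
    split_ifs with hτ
    · rw [hχ τ hτ, Finset.prod_eq_one fun i _ => ?_]
      · simp
      · have hi : n.ports (τ i) = n.ports i := congrFun hτ i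
        exact (congrArg (fun l => (1 : Matrix (Fin M) (Fin M) ℂ) l (n.ports i)) hi).trans
          (Matrix.one_apply_eq _)
    · obtain ⟨i, hi⟩ : ∃ i, n.ports (τ i) ≠ n.ports i := by
        by_contra! h; exact hτ (funext h)
      rw [Finset.prod_eq_zero (Finset.mem_univ i), mul_zero]
      simp [hi]
  rw [amplitude, h, sqrt_fact_mul_fact, sqrt_fact_mul_self, div_self]
  exact_mod_cast n.fact_ne_zero

theorem star_amplitude (U : Matrix (Fin M) (Fin M) ℂ) (n s : Fock σ M N) :
    star (amplitude U n s) = amplitude Uᴴ s n := by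
  have h : Uᴴ.submatrix s.ports n.ports = (U.submatrix n.ports s.ports)ᴴ := rfl
  rw [amplitude, amplitude, h, perDet_conjTranspose, mul_comm (s.fact : ℝ), star_div₀]
  exact congrArg _ (Complex.conj_ofReal _)

theorem amplitude_diagonal_mul (d : Fin M → ℂ) (U : Matrix (Fin M) (Fin M) ℂ)
    (n s : Fock σ M N) :
    amplitude (Matrix.diagonal d * U) n s = (∏ l, d l ^ n.1 l) * amplitude U n s := by
  rw [amplitude, amplitude, ← n.prod_ports, mul_div_assoc', perDet_eq_sum, perDet_eq_sum,
    Finset.mul_sum]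
  congr 1
  refine Finset.sum_congr rfl fun τ _ => ?_
  rw [← Equiv.prod_comp τ fun i => d (n.ports i)]
  simp only [Matrix.submatrix_apply, Matrix.diagonal_mul, Finset.prod_mul_distrib]
  ring

theorem continuous_amplitude (n s : Fock σ M N) :
    Continuous fun U : Matrix.unitaryGroup (Fin M) ℂ => amplitude U.1 n s := by
  unfold amplitude
  simp only [perDet_eq_sum, Matrix.submatrix_apply]
  refine Continuous.div_const (continuous_finsetSum _ fun τ _ => continuous_const.mul
    (continuous_finsetProd _ fun i _ => ?_)) _
  exact (continuous_subtype_val.matrix_elem _ _)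

theorem integrable_haarU_of_continuous {E : Type*} [NormedAddCommGroup E]
    {f : Matrix.unitaryGroup (Fin M) ℂ → E} (hf : Continuous f) : Integrable f (haarU M) :=
  hf.integrable_of_hasCompactSupport (HasCompactSupport.of_compactSpace f)

instance (M : ℕ) : (haarU M).IsMulLeftInvariant := by
  unfold haarU; infer_instance

/-- The composition law applied to `Uᴴ * U = 1`: the induced operator on the Fock space has
normalized columns. -/
theorem sum_normSq_amplitude (U : Matrix.unitaryGroup (Fin M) ℂ) (s : Fock σ M N) :
    ∑ n, amplitude U.1 n s * star (amplitude U.1 n s) = 1 := by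
  rw [← amplitude_one_self s, ← (Matrix.mem_unitaryGroup_iff'.mp U.2), amplitude_mul]
  refine Finset.sum_congr rfl fun n _ => ?_
  rw [star_amplitude, mul_comm]
  rfl

end Amplitude

/-! ### The Haar average of the transition operator -/

section Haar

variable {σ : Statistics} {M N : ℕ}

/-- The Haar average of the transition operator to the output `s`. -/
noncomputable def avgTransition (s n m : Fock σ M N) : ℂ :=
  ∫ U : Matrix.unitaryGroup (Fin M) ℂ, amplitude U.1 n s * star (amplitude U.1 m s) ∂(haarU M)

theorem integrable_amplitude_mul_star (n m s s' : Fock σ M N) :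
    Integrable (fun U : Matrix.unitaryGroup (Fin M) ℂ =>
      amplitude U.1 n s * star (amplitude U.1 m s')) (haarU M) :=
  integrable_haarU_of_continuous
    ((continuous_amplitude n s).mul (continuous_amplitude m s').star)

theorem avgTransition_mul_left (V : Matrix.unitaryGroup (Fin M) ℂ) (s n m : Fock σ M N) :
    avgTransition s n m = ∫ U : Matrix.unitaryGroup (Fin M) ℂ,
      amplitude (V.1 * U.1) n s * star (amplitude (V.1 * U.1) m s) ∂(haarU M) :=
  (integral_mul_left_eq_self (μ := haarU M) (fun U : Matrix.unitaryGroup (Fin M) ℂ =>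
    amplitude U.1 n s * star (amplitude U.1 m s)) V).symm

theorem avgTransition_of_ne (s : Fock σ M N) {n m : Fock σ M N} (hnm : n ≠ m) :
    avgTransition s n m = 0 := by
  obtain ⟨l, hl⟩ : ∃ l, n.1 l ≠ m.1 l := by
    by_contra! h; exact hnm (Fock.ext h)
  have hle : ∀ k : Fock σ M N, k.1 l ≤ N := fun k => by
    conv_rhs => rw [← k.2.1]
    exact Finset.single_le_sum (fun _ _ => Nat.zero_le _) (Finset.mem_univ l)
  -- Occupations lie in `0, …, N`, so a root of unity of order `N + 1` has different powers at
  -- different occupations. It is used as a phase on the single port where `n` and `m` differ.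
  obtain ⟨ω, hω⟩ : ∃ ω : ℂ, IsPrimitiveRoot ω (N + 1) :=
    ⟨_, Complex.isPrimitiveRoot_exp (N + 1) N.succ_ne_zero⟩
  have hωn : ω * star ω = 1 := by
    rw [Complex.star_def, Complex.mul_conj, Complex.normSq_eq_norm_sq,
      hω.norm'_eq_one N.succ_ne_zero]
    simp
  set d : Fin M → ℂ := Function.update 1 l ω with hd
  have hdstar : ∀ i, d i * star (d i) = 1 := by
    intro i
    by_cases h : i = l
    · subst h; simpa [hd] using hωn
    · simp [hd, h]
  have hV : Matrix.diagonal d ∈ Matrix.unitaryGroup (Fin M) ℂ := by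
    rw [Matrix.mem_unitaryGroup_iff, Matrix.star_eq_conjTranspose, Matrix.diagonal_conjTranspose,
      Matrix.diagonal_mul_diagonal, ← Matrix.diagonal_one]
    exact congrArg _ (funext hdstar)
  have hprod : ∀ k : Fock σ M N, ∏ i, d i ^ k.1 i = ω ^ k.1 l := by
    intro k
    rw [Finset.prod_eq_single l]
    · simp [hd]
    · intro i _ h; simp [hd, h]
    · simp
  have h := avgTransition_mul_left ⟨_, hV⟩ s n m
  simp only [amplitude_diagonal_mul, hprod] at h
  have h' : avgTransition s n m =
      (ω ^ n.1 l * star (ω ^ m.1 l)) * avgTransition s n m := by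
    conv_lhs => rw [h]
    rw [avgTransition, ← integral_const_mul]
    congr 1
    funext U
    rw [star_mul']
    ring
  by_contra h0
  have h1 : ω ^ n.1 l * star (ω ^ m.1 l) = 1 :=
    mul_right_cancel₀ h0 (by rw [one_mul]; exact h'.symm)
  have h2 : ω ^ m.1 l * star (ω ^ m.1 l) = 1 := by
    rw [star_pow, ← mul_pow, hωn, one_pow]
  have h3 : star (ω ^ m.1 l) ≠ 0 := right_ne_zero_of_mul_eq_one h2
  exact hl (hω.pow_inj (Nat.lt_succ_of_le (hle n)) (Nat.lt_succ_of_le (hle m))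
    (mul_right_cancel₀ h3 (h1.trans h2.symm)))

/-- The averaged transition operator commutes with every network. -/
theorem avgTransition_comm (V : Matrix.unitaryGroup (Fin M) ℂ) (s n k : Fock σ M N) :
    amplitude V.1 n k * avgTransition s k k = avgTransition s n n * amplitude V.1 n k := by
  -- One mixed integral is evaluated twice: by expanding `V * U` directly, and after translating by
  -- `V`, which moves the factor to the conjugated amplitude as `V⁻¹`. In both cases the vanishing
  -- of off-diagonal entries leaves one term.
  have h1 : ∫ U : Matrix.unitaryGroup (Fin M) ℂ,
      amplitude (V.1 * U.1) n s * star (amplitude U.1 k s) ∂(haarU M) =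
      amplitude V.1 n k * avgTransition s k k := by
    simp only [amplitude_mul, Finset.sum_mul, mul_assoc]
    rw [integral_finsetSum _ fun m _ => (integrable_amplitude_mul_star m k s s).const_mul _]
    simp only [integral_const_mul]
    rw [Finset.sum_eq_single k]
    · rfl
    · intro m _ hm
      exact mul_eq_zero_of_right _ (avgTransition_of_ne s hm)
    · simp
  have h2 : ∫ U : Matrix.unitaryGroup (Fin M) ℂ,
      amplitude (V.1 * U.1) n s * star (amplitude U.1 k s) ∂(haarU M) =
      avgTransition s n n * amplitude V.1 n k := by
    have hinv := integral_mul_left_eq_self (μ := haarU M)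
      (fun U : Matrix.unitaryGroup (Fin M) ℂ =>
        amplitude U.1 n s * star (amplitude ((V⁻¹).1 * U.1) k s)) V
    have hfun : ∀ U : Matrix.unitaryGroup (Fin M) ℂ,
        amplitude (V * U).1 n s * star (amplitude ((V⁻¹).1 * (V * U).1) k s) =
        amplitude (V.1 * U.1) n s * star (amplitude U.1 k s) := by
      intro U
      have : (V⁻¹).1 * (V * U).1 = U.1 := by
        rw [← Submonoid.coe_mul, inv_mul_cancel_left]
      rw [this]
      rfl
    simp only [hfun] at hinv
    rw [hinv]
    simp only [amplitude_mul, star_sum, Finset.mul_sum, star_mul']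
    have hterm : ∀ (m : Fock σ M N) (U : Matrix.unitaryGroup (Fin M) ℂ),
        amplitude U.1 n s * (star (amplitude (V⁻¹).1 k m) * star (amplitude U.1 m s)) =
        amplitude V.1 m k * (amplitude U.1 n s * star (amplitude U.1 m s)) := by
      intro m U
      rw [star_amplitude (V⁻¹).1, show ((V⁻¹).1)ᴴ = V.1 from star_star V.1]
      ring
    simp only [hterm]
    rw [integral_finsetSum _ fun m _ => (integrable_amplitude_mul_star n m s s).const_mul _]
    simp only [integral_const_mul]
    rw [Finset.sum_eq_single n]
    · exact mul_comm _ _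
    · intro m _ hm
      exact mul_eq_zero_of_right _ (avgTransition_of_ne s hm.symm)
    · simp
  exact h1.symm.trans h2

/-- Two fermionic Fock states are connected by a permutation of the ports. -/
theorem exists_amplitude_ne_zero_fermion (n k : Fock .fermion M N) :
    ∃ V : Matrix.unitaryGroup (Fin M) ℂ, amplitude V.1 n k ≠ 0 := by
  obtain ⟨π, hπ⟩ := Equiv.Perm.exists_extending_pair n.ports k.ports n.ports_injective
    k.ports_injective
  have hV : Matrix.of (fun i j => if π i = j then (1 : ℂ) else 0) ∈
      Matrix.unitaryGroup (Fin M) ℂ := by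
    rw [Matrix.mem_unitaryGroup_iff]
    ext i j
    simp [Matrix.mul_apply, Matrix.star_apply, Matrix.one_apply, eq_comm]
  refine ⟨⟨_, hV⟩, ?_⟩
  have h : (Matrix.of (fun i j => if π i = j then (1 : ℂ) else 0)).submatrix n.ports k.ports =
      1 := by
    ext i j
    simp [hπ, Matrix.one_apply, k.ports_injective.eq_iff]
  simp only [amplitude, h, perDet, Matrix.det_one]
  simp [Fock.fact_fermion]

/-- All bosons in one port. -/
def Fock.condensate (M N : ℕ) : Fock .boson (M + 1) N :=
  ⟨Pi.single 0 N, by simp, fun h => nomatch h⟩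

/-- A network without vanishing entries in its first column. -/
theorem exists_unitary_ne_zero (M : ℕ) :
    ∃ V : Matrix.unitaryGroup (Fin (M + 1)) ℂ, ∀ i, V.1 i 0 ≠ 0 := by
  -- With this constant, `1 + J` has eigenvalue `i` on the uniform vector and `1` on its complement,
  -- hence is unitary. The reflection with eigenvalue `-1` would have vanishing diagonal entries for
  -- two ports.
  set c : ℂ := (Complex.I - 1) / ((M + 1 : ℕ) : ℂ) with hc
  have hM : ((M + 1 : ℕ) : ℂ) ≠ 0 := by exact_mod_cast M.succ_ne_zero
  have hcc : c + star c + c * star c * ((M + 1 : ℕ) : ℂ) = 0 := by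
    have hstar : star c = (-Complex.I - 1) / ((M + 1 : ℕ) : ℂ) := by
      rw [hc, star_div₀]; simp
    rw [hstar, hc]
    field_simp
    linear_combination (-1) * Complex.I_sq
  have hc0 : c ≠ 0 := by
    refine div_ne_zero (fun h => ?_) hM
    have := congrArg Complex.im h
    simp at this
  have hc1 : 1 + c ≠ 0 := by
    intro h
    have h' := congrArg (fun z : ℂ => (z * ((M + 1 : ℕ) : ℂ)).im) h
    simp only [hc, add_mul, div_mul_cancel₀ _ hM] at h'
    simp at h'
  set J : Matrix (Fin (M + 1)) (Fin (M + 1)) ℂ := Matrix.of fun _ _ => c with hJ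
  have hV : 1 + J ∈ Matrix.unitaryGroup (Fin (M + 1)) ℂ := by
    have hJJ : J + star J + J * star J = 0 := by
      ext i j
      simp only [hJ, Matrix.add_apply, Matrix.mul_apply, Matrix.star_apply, Matrix.of_apply,
        Finset.sum_const, Finset.card_univ, Fintype.card_fin, nsmul_eq_mul, Matrix.zero_apply]
      linear_combination hcc
    rw [Matrix.mem_unitaryGroup_iff, star_add, star_one]
    calc (1 + J) * (1 + star J) = 1 + (J + star J + J * star J) := by noncomm_ring
      _ = 1 := by rw [hJJ, add_zero]
  refine ⟨⟨_, hV⟩, fun i => ?_⟩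
  simp only [hJ, Matrix.add_apply, Matrix.of_apply, Matrix.one_apply]
  split_ifs
  · exact hc1
  · simpa using hc0

/-- When all outputs coincide, the `N!` terms of the permanent are equal and cannot cancel; each is
a product of entries of one column. -/
theorem exists_amplitude_ne_zero_boson :
    ∃ V : Matrix.unitaryGroup (Fin (M + 1)) ℂ, ∀ n : Fock .boson (M + 1) N,
      amplitude V.1 n (Fock.condensate M N) ≠ 0 := by
  obtain ⟨V, hV⟩ := exists_unitary_ne_zero M
  refine ⟨V, fun n => ?_⟩
  have hports : ∀ i, (Fock.condensate M N).ports i = 0 := by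
    intro i
    by_contra hne
    have h := (Fock.condensate M N).card_ports_eq ((Fock.condensate M N).ports i)
    have h0 : (Fock.condensate M N).1 ((Fock.condensate M N).ports i) = 0 :=
      Pi.single_eq_of_ne hne _
    rw [h0, Fintype.card_eq_zero_iff] at h
    exact h.elim ⟨i, rfl⟩
  refine div_ne_zero ?_ ?_
  · simp only [perDet, Matrix.permanent, Matrix.submatrix_apply, hports]
    have : ∀ τ : Equiv.Perm (Fin N), ∏ i, V.1 (n.ports (τ i)) 0 = ∏ i, V.1 (n.ports i) 0 :=
      fun τ => Equiv.prod_comp τ fun i => V.1 (n.ports i) 0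
    simp only [this, Finset.sum_const, nsmul_eq_mul]
    refine mul_ne_zero ?_ (Finset.prod_ne_zero_iff.mpr fun i _ => hV _)
    simp [Fintype.card_perm, Nat.factorial_ne_zero]
  · rw [sqrt_fact_mul_fact]
    exact mul_ne_zero (sqrt_fact_ne_zero _) (sqrt_fact_ne_zero _)

/-- A nonzero amplitude can be cancelled from the commutation relation. Bosonic states are all
compared with the condensate, fermionic ones with each other directly. -/
theorem avgTransition_diag_eq (s n k : Fock σ M N) :
    avgTransition s n n = avgTransition s k k := by
  cases σ
  · rcases M with _ | M
    · rw [show n = k from Fock.ext fun l => l.elim0]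
    · obtain ⟨V, hV⟩ := exists_amplitude_ne_zero_boson (M := M) (N := N)
      have h : ∀ m, avgTransition s m m =
          avgTransition s (Fock.condensate M N) (Fock.condensate M N) := fun m =>
        mul_right_cancel₀ (hV m)
          ((avgTransition_comm V s m (Fock.condensate M N)).symm.trans (mul_comm _ _))
      rw [h n, h k]
  · obtain ⟨V, hV⟩ := exists_amplitude_ne_zero_fermion n k
    exact mul_right_cancel₀ hV ((avgTransition_comm V s n k).symm.trans (mul_comm _ _))

/-- The Haar average of the transition operator is the normalized identity. -/
theorem avgTransition_eq (s n m : Fock σ M N) :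
    avgTransition s n m = if n = m then ((Fintype.card (Fock σ M N) : ℂ))⁻¹ else 0 := by
  split_ifs with h
  · subst h
    -- The sum over inputs is one for every network, hence on average; this fixes the common
    -- diagonal value.
    have htot : ∑ k, avgTransition s k k = 1 := by
      simp only [avgTransition]
      rw [← integral_finsetSum _ fun k _ => integrable_amplitude_mul_star k k s s]
      simp only [sum_normSq_amplitude]
      simp
    rw [Finset.sum_congr rfl fun k _ => avgTransition_diag_eq s k n, Finset.sum_const,
      nsmul_eq_mul, Finset.card_univ] at htot
    exact eq_inv_of_mul_eq_one_right htot
  · exact avgTransition_of_ne s h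

end Haar

/-! ### Counting Fock states, in total and with prescribed bin counts -/

section Counting

/-- `∏ (K ± l) / n!`, the number of ways to distribute `n` particles over `K` ports. -/
noncomputable def distributions (σ : Statistics) (K : ℝ) (n : ℕ) : ℝ :=
  (∏ l ∈ Finset.range n, (K + σ.sgn * (l : ℝ))) / (n.factorial : ℝ)

theorem distributions_boson (K n : ℕ) :
    distributions .boson K n = (K.multichoose n : ℝ) := by
  have h : (K.ascFactorial n : ℝ) = n.factorial * K.multichoose n := by
    rw [Nat.multichoose_eq]
    exact_mod_cast Nat.ascFactorial_eq_factorial_mul_choose' K n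
  rw [distributions, div_eq_iff (by exact_mod_cast n.factorial_ne_zero), mul_comm, ← h,
    Nat.ascFactorial_eq_prod_range]
  simp [Statistics.sgn]

theorem distributions_fermion (K n : ℕ) :
    distributions .fermion K n = (K.choose n : ℝ) := by
  have h : (K.descFactorial n : ℝ) = n.factorial * K.choose n := by
    exact_mod_cast Nat.descFactorial_eq_factorial_mul_choose K n
  rw [distributions, div_eq_iff (by exact_mod_cast n.factorial_ne_zero), mul_comm, ← h,
    ← descPochhammer_eval_eq_descFactorial, descPochhammer_eval_eq_prod_range]
  simp [Statistics.sgn, sub_eq_add_neg]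

/-- Occupation numbers at most one are the same as sets. -/
def occupationsEquivFinset (ι : Type*) [Fintype ι] [DecidableEq ι] (n : ℕ) :
    {g : ι → ℕ // ∑ l, g l = n ∧ ∀ l, g l ≤ 1} ≃ {s : Finset ι // s.card = n} where
  toFun g := ⟨Finset.univ.filter fun l => g.1 l = 1, by
    refine Eq.trans ?_ g.2.1
    rw [Finset.card_filter]
    refine Finset.sum_congr rfl fun l _ => ?_
    have := g.2.2 l
    split_ifs <;> omega⟩
  invFun s := ⟨fun l => if l ∈ s.1 then 1 else 0, by simp [s.2], fun l => by
    dsimp only; split_ifs <;> simp⟩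
  left_inv g := by
    refine Subtype.ext (funext fun l => ?_)
    have := g.2.2 l
    simp only [Finset.mem_filter, Finset.mem_univ, true_and]
    split_ifs <;> omega
  right_inv s := by
    refine Subtype.ext (Finset.ext fun l => ?_)
    simp

/-- Bosonic occupations are multisets and fermionic ones are subsets. An arbitrary finite type of
ports is allowed so that this covers the whole network and each single bin. -/
theorem card_occupations (σ : Statistics) (ι : Type*) [Fintype ι] (n : ℕ) :
    (Nat.card {g : ι → ℕ // ∑ l, g l = n ∧ (σ = .fermion → ∀ l, g l ≤ 1)} : ℝ) =
      distributions σ (Fintype.card ι) n := by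
  classical
  cases σ
  · rw [distributions_boson, ← Sym.card_sym_eq_multichoose ι n, ← Nat.card_eq_fintype_card]
    congr 1
    refine Nat.card_congr (Equiv.trans ?_ (Sym.equivNatSumOfFintype ι n).symm)
    exact Equiv.subtypeEquivRight fun g => by simp
  · rw [distributions_fermion, ← Fintype.card_finset_len, ← Nat.card_eq_fintype_card]
    congr 1
    refine Nat.card_congr (Equiv.trans ?_ (occupationsEquivFinset ι n))
    exact Equiv.subtypeEquivRight fun g => by simp

variable {σ : Statistics} {M N : ℕ}

theorem card_fock : (Fintype.card (Fock σ M N) : ℝ) = distributions σ M N := by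
  rw [← Nat.card_eq_fintype_card]
  exact (card_occupations σ (Fin M) N).trans (by simp)

theorem uniformProb_eq_inv : uniformProb σ M N = (distributions σ M N)⁻¹ := by
  rw [uniformProb, distributions, inv_div]

/-- Distributing particles over the ports with prescribed bin counts amounts to distributing them
bin by bin. -/
def binnedEquiv {r : ℕ} (b : Fin M → Fin r) (n : Fin r → ℕ) (hn : ∑ i, n i = N) :
    {s : Fock σ M N // ∀ i, ∑ l ∈ Finset.univ.filter (fun l => b l = i), s.1 l = n i} ≃
      ∀ i, {g : {l // b l = i} → ℕ // ∑ l, g l = n i ∧ (σ = .fermion → ∀ l, g l ≤ 1)} where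
  toFun s i := ⟨fun l => s.1.1 l.1, by
    rw [← s.2 i]
    exact (Finset.sum_subtype _ (fun l => by simp) fun l => s.1.1 l).symm,
    fun h l => s.1.2.2 h l⟩
  invFun g :=
    have hg : ∀ i, ∑ l ∈ Finset.univ.filter (fun l => b l = i), (g (b l)).1 ⟨l, rfl⟩ = n i := by
      intro i
      rw [← (g i).2.1, Finset.sum_subtype (p := fun l => b l = i) _ (fun l => by simp)]
      refine Finset.sum_congr rfl fun l _ => ?_
      obtain ⟨l, rfl⟩ := l
      rfl
    ⟨⟨fun l => (g (b l)).1 ⟨l, rfl⟩, by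
      rw [← hn, ← Finset.sum_congr rfl fun i _ => hg i]
      exact (Finset.sum_fiberwise_of_maps_to (fun _ _ => Finset.mem_univ _) _).symm,
      fun h l => (g (b l)).2.2 h _⟩, hg⟩
  left_inv s := rfl
  right_inv g := by
    funext i
    refine Subtype.ext (funext fun l => ?_)
    obtain ⟨l, rfl⟩ := l
    rfl

open Classical in
theorem card_binned {r : ℕ} (b : Fin M → Fin r) (n : Fin r → ℕ) (hn : ∑ i, n i = N) :
    ((Finset.univ.filter (fun s : Fock σ M N =>
      ∀ i, ∑ l ∈ Finset.univ.filter (fun l => b l = i), s.1 l = n i)).card : ℝ) =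
      ∏ i, distributions σ (binSize b i) (n i) := by
  rw [← Fintype.card_subtype, ← Nat.card_eq_fintype_card]
  have h := Nat.card_congr (binnedEquiv (σ := σ) b n hn)
  rw [Nat.card_pi] at h
  have h' : ∀ i, (Nat.card {g : {l // b l = i} → ℕ //
      ∑ l, g l = n i ∧ (σ = .fermion → ∀ l, g l ≤ 1)} : ℝ) =
      distributions σ (binSize b i) (n i) := fun i => by
    rw [card_occupations, Fintype.card_subtype]; rfl
  rw [← Finset.prod_congr rfl fun i _ => h' i, ← Nat.cast_prod, ← h]

end Counting

/-! ### Exact averages for states and bins -/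

section ExactAverages

variable {σ : Statistics} {M N : ℕ}

theorem avgTransition_eq_uniformProb (s n m : Fock σ M N) :
    avgTransition s n m = if n = m then (uniformProb σ M N : ℂ) else 0 := by
  rw [avgTransition_eq, uniformProb_eq_inv, ← card_fock]
  simp

theorem integrable_outExpectation (ρ : Matrix (Fock σ M N) (Fock σ M N) ℂ) (s : Fock σ M N) :
    Integrable (fun U : Matrix.unitaryGroup (Fin M) ℂ => outExpectation ρ U.1 s) (haarU M) :=
  integrable_finsetSum _ fun n _ => integrable_finsetSum _ fun m _ =>
    (integrable_amplitude_mul_star n m s s).const_mul _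

theorem integrable_outProb (ρ : Matrix (Fock σ M N) (Fock σ M N) ℂ) (s : Fock σ M N) :
    Integrable (fun U : Matrix.unitaryGroup (Fin M) ℂ => outProb ρ U.1 s) (haarU M) :=
  (integrable_outExpectation ρ s).re

/-- The averaged transition operator is scalar, so only the trace of `ρ` survives. Positivity plays
no role, so Fock inputs given by `Matrix.single` are included at once. -/
theorem avgOutProb_eq_trace (ρ : Matrix (Fock σ M N) (Fock σ M N) ℂ) (s : Fock σ M N) :
    avgOutProb ρ s = uniformProb σ M N * ∑ n, (ρ n n).re := by
  have h : ∫ U : Matrix.unitaryGroup (Fin M) ℂ, outExpectation ρ U.1 s ∂(haarU M) =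
      ∑ n, ρ n n * (uniformProb σ M N : ℂ) := by
    refine (integral_finsetSum _ fun n _ => integrable_finsetSum _ fun m _ =>
      (integrable_amplitude_mul_star n m s s).const_mul _).trans ?_
    refine Finset.sum_congr rfl fun n _ => ?_
    refine (integral_finsetSum _ fun m _ =>
      (integrable_amplitude_mul_star n m s s).const_mul _).trans ?_
    simp only [integral_const_mul]
    change ∑ m, ρ n m * avgTransition s n m = _
    simp [avgTransition_eq_uniformProb]
  have h' : avgOutProb ρ s =
      (∫ U : Matrix.unitaryGroup (Fin M) ℂ, outExpectation ρ U.1 s ∂(haarU M)).re :=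
    integral_re (integrable_outExpectation ρ s)
  rw [h', h, Complex.re_sum, Finset.mul_sum]
  exact Finset.sum_congr rfl fun n _ => by rw [Complex.re_mul_ofReal, mul_comm]

theorem sum_re_diag_of_trace_eq_one {ρ : Matrix (Fock σ M N) (Fock σ M N) ℂ}
    (hρ : ρ.trace = 1) : ∑ n, (ρ n n).re = 1 := by
  rw [← Complex.re_sum]
  exact congrArg Complex.re hρ

theorem avgOutProb_single (n s : Fock σ M N) :
    avgOutProb (Matrix.single n n 1) s = uniformProb σ M N := by
  rw [avgOutProb_eq_trace, sum_re_diag_of_trace_eq_one, mul_one]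
  simp

theorem avgOutProb_of_isState {ρ : Matrix (Fock σ M N) (Fock σ M N) ℂ} (hρ : IsState ρ)
    (s : Fock σ M N) : avgOutProb ρ s = uniformProb σ M N := by
  rw [avgOutProb_eq_trace, sum_re_diag_of_trace_eq_one hρ.2, mul_one]

theorem integrable_binProb {r : ℕ} (ρ : Matrix (Fock σ M N) (Fock σ M N) ℂ)
    (b : Fin M → Fin r) (n : Fin r → ℕ) :
    Integrable (fun U : Matrix.unitaryGroup (Fin M) ℂ => binProb ρ U.1 b n) (haarU M) :=
  integrable_finsetSum _ fun s _ => integrable_outProb ρ s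

theorem avgBinProb_eq {r : ℕ} {ρ : Matrix (Fock σ M N) (Fock σ M N) ℂ} (hρ : IsState ρ)
    (b : Fin M → Fin r) (n : Fin r → ℕ) (hn : ∑ i, n i = N) :
    avgBinProb ρ b n =
      uniformProb σ M N * ∏ i, distributions σ (binSize b i) (n i) := by
  refine (integral_finsetSum _ fun s _ => integrable_outProb ρ s).trans ?_
  refine (Finset.sum_congr rfl fun s _ => avgOutProb_of_isState hρ s).trans ?_
  rw [Finset.sum_const, nsmul_eq_mul, card_binned b n hn, mul_comm]

end ExactAverages

/-! ### Stirling's formula with explicit error -/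

section Stirling

theorem log_stirlingSeq_le {n : ℕ} (hn : n ≠ 0) :
    Real.log (Stirling.stirlingSeq n) ≤ Real.log (Real.sqrt Real.pi) + 1 / (12 * n) := by
  obtain ⟨m, rfl⟩ := Nat.exists_eq_succ_of_ne_zero hn
  -- The decrements of `log (stirlingSeq n)` are at most `1 / (12 n (n + 1))`, which telescopes to
  -- `1 / (12 n)`; the corrected sequence increases to the logarithm of `√π`.
  have hmono : Monotone fun k : ℕ =>
      Real.log (Stirling.stirlingSeq (k + 1)) - 1 / (12 * ((k : ℝ) + 1)) := by
    refine monotone_nat_of_le_succ fun k => ?_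
    have h := Stirling.log_stirlingSeq_sdiff_le (k + 1)
    have h2 : (1 : ℝ) / (12 * ((k : ℝ) + 1)) - 1 / (12 * (((k + 1 : ℕ) : ℝ) + 1)) =
        1 / (12 * ((k + 1 : ℕ) : ℝ) * (((k + 1 : ℕ) : ℝ) + 1)) := by
      push_cast
      field_simp
      ring
    linarith
  have hlim : Filter.Tendsto (fun k : ℕ =>
      Real.log (Stirling.stirlingSeq (k + 1)) - 1 / (12 * ((k : ℝ) + 1))) Filter.atTop
      (nhds (Real.log (Real.sqrt Real.pi) - 0)) := by
    refine Filter.Tendsto.sub ?_ ?_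
    · exact (Real.continuousAt_log (by positivity)).tendsto.comp
        (Stirling.tendsto_stirlingSeq_sqrt_pi.comp (Filter.tendsto_add_atTop_nat 1))
    · have h := (tendsto_one_div_add_atTop_nhds_zero_nat (𝕜 := ℝ)).const_mul (1 / 12)
      rw [mul_zero] at h
      refine h.congr fun k => ?_
      field_simp
  have := hmono.ge_of_tendsto hlim m
  push_cast at this ⊢
  linarith

theorem abs_log_factorial_sub_le {n : ℕ} (hn : n ≠ 0) :
    |Real.log n.factorial - (n * Real.log n - n + Real.log (2 * Real.pi * n) / 2)| ≤
      1 / (n : ℝ) := by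
  have hn0 : (0 : ℝ) < n := by exact_mod_cast Nat.pos_of_ne_zero hn
  have h1 := Stirling.le_log_factorial_stirling hn
  have h2 := log_stirlingSeq_le hn
  rw [Stirling.log_stirlingSeq_formula, Real.log_sqrt Real.pi_pos.le, Real.log_div hn0.ne'
    (Real.exp_pos 1).ne', Real.log_exp, Real.log_mul two_ne_zero hn0.ne'] at h2
  rw [Real.log_mul two_ne_zero Real.pi_pos.ne'] at h1
  rw [Real.log_mul (by positivity) hn0.ne', Real.log_mul two_ne_zero Real.pi_pos.ne']
  have h3 : 1 / (12 * (n : ℝ)) ≤ 1 / (n : ℝ) :=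
    one_div_le_one_div_of_le hn0 (by linarith)
  have h4 : 0 ≤ 1 / (n : ℝ) := by positivity
  rw [abs_le]
  constructor <;> linarith

theorem Statistics.sgn_mul_sgn (σ : Statistics) : σ.sgn * σ.sgn = 1 := by
  cases σ <;> simp [Statistics.sgn]

/-- The main part of `log (distributions σ K n)` according to Stirling's formula. -/
noncomputable def logDistMain (σ : Statistics) (K n : ℝ) : ℝ :=
  σ.sgn * ((K + σ.sgn * n) * Real.log (K + σ.sgn * n) - K * Real.log K) - n * Real.log n +
    (Real.log K - Real.log (K + σ.sgn * n) - Real.log (2 * Real.pi * n)) / 2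

/-- Rewriting the count as `K / (K + n)` times `(K + n)! / (K! n!)` avoids factorials of `K - 1`.
The prefactor turns the half-logarithms of Stirling's formula into those of the fermionic case, so
`logDistMain` can serve both statistics. -/
theorem distributions_boson_mul (K n : ℕ) (hK : K ≠ 0) :
    distributions .boson K n * (K + n : ℕ) * (K.factorial * n.factorial) =
      K * (K + n).factorial := by
  obtain ⟨k, rfl⟩ := Nat.exists_eq_succ_of_ne_zero hK
  have h := Nat.factorial_mul_ascFactorial k n
  have h2 := Nat.ascFactorial_eq_factorial_mul_choose k n
  have h3 : distributions .boson (k + 1 : ℕ) n = (k + n).choose n := by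
    rw [distributions_boson, Nat.multichoose_eq]
    congr 2
    omega
  have h5 : k.factorial * (n.factorial * (k + n).choose n) = (k + n).factorial := by
    rw [← h, h2]
  rw [Nat.succ_eq_add_one, h3, show k + 1 + n = (k + n) + 1 by ring, Nat.factorial_succ (k + n),
    Nat.factorial_succ k, ← h5]
  push_cast
  ring

theorem log_distributions {σ : Statistics} {K n : ℕ} (hK : K ≠ 0) (hn : n ≠ 0)
    (hKn : 0 < (K : ℝ) + σ.sgn * n) :
    0 < distributions σ K n ∧
    |Real.log (distributions σ K n) - logDistMain σ K n| ≤
      1 / (K : ℝ) + 1 / (n : ℝ) + 1 / ((K : ℝ) + σ.sgn * n) := by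
  have hK0 : (0 : ℝ) < K := by exact_mod_cast Nat.pos_of_ne_zero hK
  have hn0 : (0 : ℝ) < n := by exact_mod_cast Nat.pos_of_ne_zero hn
  have sK := abs_le.mp (abs_log_factorial_sub_le hK)
  have sn := abs_le.mp (abs_log_factorial_sub_le hn)
  have fK : (0 : ℝ) < K.factorial := by exact_mod_cast K.factorial_pos
  have fn : (0 : ℝ) < n.factorial := by exact_mod_cast n.factorial_pos
  have l2π : ∀ {x : ℝ}, 0 < x → Real.log (2 * Real.pi * x) =
      Real.log (2 * Real.pi) + Real.log x := fun hx => Real.log_mul (by positivity) hx.ne'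
  cases σ
  · simp only [Statistics.sgn, one_mul] at hKn ⊢
    have hy : K + n ≠ 0 := by omega
    have sy := abs_le.mp (abs_log_factorial_sub_le hy)
    have fy : (0 : ℝ) < (K + n).factorial := by exact_mod_cast (K + n).factorial_pos
    have h := distributions_boson_mul K n hK
    have hpos : 0 < distributions .boson K n := by
      rw [distributions_boson]
      exact_mod_cast Nat.pos_of_ne_zero (by
        rw [Nat.multichoose_eq]; exact (Nat.choose_pos (by omega)).ne')
    refine ⟨hpos, ?_⟩
    have h' := congrArg Real.log h
    push_cast at h' sy
    rw [Real.log_mul (by positivity) (by positivity), Real.log_mul (by positivity) (by positivity),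
      Real.log_mul (by positivity) (by positivity), Real.log_mul (by positivity) (by positivity)]
      at h'
    rw [l2π hK0] at sK
    rw [l2π hn0] at sn
    rw [l2π hKn] at sy
    simp only [logDistMain, Statistics.sgn, one_mul, l2π hn0]
    rw [abs_le]
    constructor <;> linarith [sK.1, sK.2, sn.1, sn.2, sy.1, sy.2]
  · simp only [Statistics.sgn, neg_mul, one_mul] at hKn ⊢
    have hlt : n < K := by
      have : (n : ℝ) < K := by linarith
      exact_mod_cast this
    have hy : K - n ≠ 0 := by omega
    have sy := abs_le.mp (abs_log_factorial_sub_le hy)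
    have fy : (0 : ℝ) < (K - n).factorial := by exact_mod_cast (K - n).factorial_pos
    have h : distributions .fermion K n * n.factorial * (K - n).factorial = K.factorial := by
      rw [distributions_fermion]
      exact_mod_cast Nat.choose_mul_factorial_mul_factorial hlt.le
    have hpos : 0 < distributions .fermion K n := by
      rw [distributions_fermion]
      exact_mod_cast Nat.choose_pos hlt.le
    refine ⟨hpos, ?_⟩
    have h' := congrArg Real.log h
    rw [Real.log_mul (by positivity) (by positivity), Real.log_mul (by positivity) (by positivity)]
      at h'
    rw [Nat.cast_sub hlt.le] at sy
    rw [← sub_eq_add_neg] at hKn ⊢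
    rw [l2π hK0] at sK
    rw [l2π hn0] at sn
    rw [l2π hKn] at sy
    simp only [logDistMain, Statistics.sgn, neg_mul, one_mul, l2π hn0, ← sub_eq_add_neg]
    rw [abs_le]
    constructor <;> linarith [sK.1, sK.2, sn.1, sn.2, sy.1, sy.2]

end Stirling

/-! ### Taylor expansion around the mean counts -/

section Taylor

theorem abs_log_one_add_sub_le {u : ℝ} (hu : |u| ≤ 1 / 2) :
    |Real.log (1 + u) - (u - u ^ 2 / 2)| ≤ 2 * |u| ^ 3 := by
  have h := Real.abs_log_sub_add_sum_range_le (x := -u) (by rw [abs_neg]; linarith) 2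
  simp only [Finset.sum_range_succ, Finset.sum_range_zero, sub_neg_eq_add, abs_neg] at h
  norm_num at h
  have h1 : |u| ^ 3 / (1 - |u|) ≤ 2 * |u| ^ 3 := by
    rw [div_le_iff₀ (by linarith)]
    nlinarith [pow_nonneg (abs_nonneg u) 3]
  refine le_trans (le_of_eq ?_) (h.trans h1)
  congr 1
  ring

theorem abs_log_one_add_le {u : ℝ} (hu : |u| ≤ 1 / 2) : |Real.log (1 + u)| ≤ 2 * |u| := by
  have h := Real.abs_log_sub_add_sum_range_le (x := -u) (by rw [abs_neg]; linarith) 0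
  simp only [Finset.sum_range_zero, sub_neg_eq_add, abs_neg, zero_add, pow_one] at h
  refine h.trans ?_
  rw [div_le_iff₀ (by linarith)]
  nlinarith [abs_nonneg u]

theorem abs_one_add_mul_log_sub_le {u : ℝ} (hu : |u| ≤ 1 / 2) :
    |(1 + u) * Real.log (1 + u) - (u + u ^ 2 / 2)| ≤ 4 * |u| ^ 3 := by
  have h := abs_log_one_add_sub_le hu
  have h1 : (1 + u) * Real.log (1 + u) - (u + u ^ 2 / 2) =
      (1 + u) * (Real.log (1 + u) - (u - u ^ 2 / 2)) - u ^ 3 / 2 := by ring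
  have h2 : |1 + u| ≤ 3 / 2 := by
    have := abs_add_le 1 u
    rw [abs_one] at this
    linarith
  rw [h1]
  refine (abs_sub _ _).trans ?_
  rw [abs_mul, abs_div, abs_pow, abs_two]
  have h3 : |1 + u| * |Real.log (1 + u) - (u - u ^ 2 / 2)| ≤ 3 / 2 * (2 * |u| ^ 3) :=
    mul_le_mul h2 h (abs_nonneg _) (by norm_num)
  have h4 : 0 ≤ |u| ^ 3 := by positivity
  linarith

theorem abs_mul_log_sub_taylor_le {c δ : ℝ} (hc : 0 < c) (hδ : |δ| ≤ c / 2) :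
    |(c + δ) * Real.log (c + δ) -
      (c * Real.log c + δ * Real.log c + δ + δ ^ 2 / (2 * c))| ≤ 4 * (|δ| ^ 3 / c ^ 2) := by
  have hu : |δ / c| ≤ 1 / 2 := by
    rw [abs_div, abs_of_pos hc, div_le_iff₀ hc]; linarith
  have hpos : 0 < 1 + δ / c := by linarith [(abs_le.mp hu).1]
  have h := abs_one_add_mul_log_sub_le hu
  have e : c + δ = c * (1 + δ / c) := by field_simp
  have h1 : (c + δ) * Real.log (c + δ) -
      (c * Real.log c + δ * Real.log c + δ + δ ^ 2 / (2 * c)) =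
      c * ((1 + δ / c) * Real.log (1 + δ / c) - (δ / c + (δ / c) ^ 2 / 2)) := by
    rw [e, Real.log_mul hc.ne' hpos.ne']
    field_simp
    ring
  rw [h1, abs_mul, abs_of_pos hc]
  calc c * _ ≤ c * (4 * |δ / c| ^ 3) := mul_le_mul_of_nonneg_left h hc.le
    _ = 4 * (|δ| ^ 3 / c ^ 2) := by
      rw [abs_div, abs_of_pos hc]; field_simp

theorem abs_log_add_sub_log_le {c δ : ℝ} (hc : 0 < c) (hδ : |δ| ≤ c / 2) :
    |Real.log (c + δ) - Real.log c| ≤ 2 * (|δ| / c) := by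
  have hu : |δ / c| ≤ 1 / 2 := by
    rw [abs_div, abs_of_pos hc, div_le_iff₀ hc]; linarith
  have hpos : 0 < 1 + δ / c := by linarith [(abs_le.mp hu).1]
  have e : c + δ = c * (1 + δ / c) := by field_simp
  rw [e, Real.log_mul hc.ne' hpos.ne', add_sub_cancel_left, ← abs_of_pos hc, ← abs_div,
    abs_of_pos hc]
  exact abs_log_one_add_le hu

/-- Expansion of the Stirling main part of the distributions over a bin, around a bin with the
average density. -/
theorem abs_logDistMain_sub_le {σ : Statistics} {q M N δ : ℝ} (hq : 0 < q) (hM : 0 < M)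
    (hN : 0 < N) (hY : 0 < M + σ.sgn * N) (hδN : |δ| ≤ q * N / 2)
    (hδY : |δ| ≤ q * (M + σ.sgn * N) / 2) :
    |logDistMain σ (q * M) (q * N + δ) -
      (q * (σ.sgn * ((M + σ.sgn * N) * Real.log (M + σ.sgn * N) - M * Real.log M) -
          N * Real.log N) +
        δ * (Real.log (M + σ.sgn * N) - Real.log N) -
        δ ^ 2 * M / (2 * q * N * (M + σ.sgn * N)) +
        (Real.log M - Real.log (M + σ.sgn * N) - Real.log (2 * Real.pi * N)) / 2 -
        Real.log q / 2)| ≤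
      4 * (|δ| ^ 3 / (q * N) ^ 2) + 4 * (|δ| ^ 3 / (q * (M + σ.sgn * N)) ^ 2) +
        |δ| / (q * N) + |δ| / (q * (M + σ.sgn * N)) := by
  have hs := σ.sgn_mul_sgn
  have hs1 : |σ.sgn| = 1 := by cases σ <;> simp [Statistics.sgn]
  set s := σ.sgn with hsdef
  set Y := M + s * N with hYdef
  have ha : 0 < q * N := by positivity
  have hc : 0 < q * Y := by positivity
  have hsδ : |s * δ| = |δ| := by rw [abs_mul, hs1, one_mul]
  have t1 := abs_le.mp (abs_mul_log_sub_taylor_le ha hδN)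
  have t2 : |s * ((q * Y + s * δ) * Real.log (q * Y + s * δ) - (q * Y * Real.log (q * Y) +
      s * δ * Real.log (q * Y) + s * δ + (s * δ) ^ 2 / (2 * (q * Y))))| ≤
      4 * (|δ| ^ 3 / (q * Y) ^ 2) := by
    have := abs_mul_log_sub_taylor_le hc (δ := s * δ) (by rw [hsδ]; exact hδY)
    rwa [abs_mul, hs1, one_mul, ← hsδ]
  replace t2 := abs_le.mp t2
  have l1 := abs_le.mp (abs_log_add_sub_log_le ha hδN)
  have l2 := abs_log_add_sub_log_le hc (δ := s * δ) (by rw [hsδ]; exact hδY)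
  rw [hsδ] at l2
  replace l2 := abs_le.mp l2
  have e1 : q * M + s * (q * N + δ) = q * Y + s * δ := by rw [hYdef]; ring
  have hpos : 0 < q * N + δ := by linarith [(abs_le.mp hδN).1]
  have lqN : Real.log (q * N) = Real.log q + Real.log N := Real.log_mul hq.ne' hN.ne'
  have lqM : Real.log (q * M) = Real.log q + Real.log M := Real.log_mul hq.ne' hM.ne'
  have lqY : Real.log (q * Y) = Real.log q + Real.log Y := Real.log_mul hq.ne' hY.ne'
  have l3 : Real.log (2 * Real.pi * (q * N + δ)) =
      Real.log (2 * Real.pi) + Real.log (q * N + δ) := Real.log_mul (by positivity) hpos.ne'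
  have l4 : Real.log (2 * Real.pi * N) =
      Real.log (2 * Real.pi) + Real.log N := Real.log_mul (by positivity) hN.ne'
  -- The partial fractions `1 / N - s / (M + s N) = M / (N (M + s N))` merge the quadratic terms of
  -- both entropies; this is the origin of the variance factor `1 + σα`.
  have equad : δ ^ 2 * M / (2 * q * N * Y) =
      δ ^ 2 / (2 * (q * N)) - s * ((s * δ) ^ 2 / (2 * (q * Y))) := by
    have : M = Y - s * N := by rw [hYdef]; ring
    rw [this]
    field_simp
    linear_combination (s * N * δ ^ 2) * hs
  -- Since `s * s = 1`, the multiples of `log q` of order `N` and the bare terms `δ` cancel; of `log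
  -- q` only the half-logarithm remains.
  have key : logDistMain σ (q * M) (q * N + δ) -
      (q * (s * (Y * Real.log Y - M * Real.log M) - N * Real.log N) +
        δ * (Real.log Y - Real.log N) - δ ^ 2 * M / (2 * q * N * Y) +
        (Real.log M - Real.log Y - Real.log (2 * Real.pi * N)) / 2 - Real.log q / 2) =
      s * ((q * Y + s * δ) * Real.log (q * Y + s * δ) - (q * Y * Real.log (q * Y) +
        s * δ * Real.log (q * Y) + s * δ + (s * δ) ^ 2 / (2 * (q * Y)))) -
      ((q * N + δ) * Real.log (q * N + δ) - (q * N * Real.log (q * N) +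
        δ * Real.log (q * N) + δ + δ ^ 2 / (2 * (q * N)))) -
      (Real.log (q * Y + s * δ) - Real.log (q * Y)) / 2 -
      (Real.log (q * N + δ) - Real.log (q * N)) / 2 := by
    rw [logDistMain, ← hsdef, e1, l3, l4, equad, lqN, lqM, lqY, hYdef]
    linear_combination (q * N * Real.log q + δ * Real.log q + δ * Real.log (M + s * N) + δ) * hs
  rw [key, abs_le]
  constructor <;> linarith [t1.1, t1.2, t2.1, t2.2, l1.1, l1.2, l2.1, l2.2]

end Taylor

/-! ### The Gaussian law inside the window -/

section GaussianLaw

theorem one_add_sgn_mul_density {σ : Statistics} {M N : ℕ} (hM : M ≠ 0) :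
    1 + σ.sgn * density M N = ((M : ℝ) + σ.sgn * N) / M := by
  have hM0 : (M : ℝ) ≠ 0 := by exact_mod_cast hM
  rw [density]
  field_simp

theorem log_gaussianLaw {σ : Statistics} {r : ℕ} {q : Fin r → ℝ} (hq : ∀ i, 0 < q i)
    {M N : ℕ} (hM : M ≠ 0) (hN : N ≠ 0) (hY : 0 < (M : ℝ) + σ.sgn * N) (n : Fin r → ℕ) :
    0 < gaussianLaw σ M N q n ∧
    Real.log (gaussianLaw σ M N q n) =
      -(∑ i, ((n i : ℝ) - N * q i) ^ 2 * M / (2 * q i * N * ((M : ℝ) + σ.sgn * N))) +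
      ((r : ℝ) - 1) * ((Real.log M - Real.log ((M : ℝ) + σ.sgn * N) -
        Real.log (2 * Real.pi * N)) / 2) - ∑ i, Real.log (q i) / 2 := by
  have hM0 : (0 : ℝ) < M := by exact_mod_cast Nat.pos_of_ne_zero hM
  have hN0 : (0 : ℝ) < N := by exact_mod_cast Nat.pos_of_ne_zero hN
  have hsq : ∀ i, 0 < Real.sqrt (q i) := fun i => Real.sqrt_pos.mpr (hq i)
  have hprod : 0 < ∏ i, Real.sqrt (q i) := Finset.prod_pos fun i _ => hsq i
  rw [gaussianLaw, one_add_sgn_mul_density hM]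
  set Y := (M : ℝ) + σ.sgn * N with hYdef
  have hbase : 0 < 2 * Real.pi * (Y / M) * N := by positivity
  have hpow : 0 < (2 * Real.pi * (Y / M) * N) ^ (((r : ℝ) - 1) / 2) := Real.rpow_pos_of_pos hbase _
  refine ⟨by positivity, ?_⟩
  rw [Real.log_div (Real.exp_pos _).ne' (mul_pos hpow hprod).ne', Real.log_exp,
    Real.log_mul hpow.ne' hprod.ne', Real.log_rpow hbase,
    Real.log_prod fun i _ => (hsq i).ne',
    Finset.sum_congr rfl fun i _ => Real.log_sqrt (hq i).le]
  have e1 : 2 * Real.pi * (Y / M) * N = (2 * Real.pi * N) * Y / M := by field_simp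
  rw [e1, Real.log_div (by positivity) hM0.ne', Real.log_mul (by positivity) hY.ne']
  have e2 : -(N : ℝ) * ∑ i, ((n i : ℝ) / N - q i) ^ 2 / (2 * (Y / M) * q i) =
      -∑ i, ((n i : ℝ) - N * q i) ^ 2 * M / (2 * q i * N * Y) := by
    rw [neg_mul, Finset.mul_sum]
    congr 1
    refine Finset.sum_congr rfl fun i _ => ?_
    have := hq i
    field_simp
  rw [e2]
  ring

/-- The logarithmic error of the Gaussian law in terms of the deviations from the mean counts. -/
theorem abs_log_binProb_sub_log_gaussianLaw_le {σ : Statistics} {r : ℕ} {q : Fin r → ℝ}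
    (hq : ∀ i, 0 < q i) (hq1 : ∑ i, q i = 1) {M N : ℕ} (hM : M ≠ 0) (hN : N ≠ 0)
    (hY : 0 < (M : ℝ) + σ.sgn * N) {K n : Fin r → ℕ} (hK : ∀ i, (K i : ℝ) = q i * M)
    (hn : ∑ i, n i = N) (h1 : ∀ i, |(n i : ℝ) - N * q i| ≤ q i * N / 2)
    (h2 : ∀ i, |(n i : ℝ) - N * q i| ≤ q i * ((M : ℝ) + σ.sgn * N) / 2) :
    0 < uniformProb σ M N * ∏ i, distributions σ (K i) (n i) ∧
    |Real.log (uniformProb σ M N * ∏ i, distributions σ (K i) (n i)) -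
        Real.log (gaussianLaw σ M N q n)| ≤
      (1 / (M : ℝ) + 1 / (N : ℝ) + 1 / ((M : ℝ) + σ.sgn * N)) +
      ∑ i, (1 / (q i * M) + 2 / (q i * N) + 2 / (q i * ((M : ℝ) + σ.sgn * N)) +
        (4 * (|(n i : ℝ) - N * q i| ^ 3 / (q i * N) ^ 2) +
          4 * (|(n i : ℝ) - N * q i| ^ 3 / (q i * ((M : ℝ) + σ.sgn * N)) ^ 2) +
          |(n i : ℝ) - N * q i| / (q i * N) +
          |(n i : ℝ) - N * q i| / (q i * ((M : ℝ) + σ.sgn * N)))) := by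
  have hM0 : (0 : ℝ) < M := by exact_mod_cast Nat.pos_of_ne_zero hM
  have hN0 : (0 : ℝ) < N := by exact_mod_cast Nat.pos_of_ne_zero hN
  have hs1 : |σ.sgn| = 1 := by cases σ <;> simp [Statistics.sgn]
  have hni : ∀ i, (n i : ℝ) = q i * N + ((n i : ℝ) - N * q i) := fun i => by ring
  have hnpos : ∀ i, q i * N / 2 ≤ n i := fun i => by linarith [(abs_le.mp (h1 i)).1]
  have hyeq : ∀ i, (K i : ℝ) + σ.sgn * n i =
      q i * ((M : ℝ) + σ.sgn * N) + σ.sgn * ((n i : ℝ) - N * q i) := fun i => by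
    rw [hK i]; ring
  have hypos : ∀ i, q i * ((M : ℝ) + σ.sgn * N) / 2 ≤ (K i : ℝ) + σ.sgn * n i := fun i => by
    have : |σ.sgn * ((n i : ℝ) - N * q i)| ≤ q i * ((M : ℝ) + σ.sgn * N) / 2 := by
      rw [abs_mul, hs1, one_mul]; exact h2 i
    rw [hyeq i]
    linarith [(abs_le.mp this).1]
  have hKpos : ∀ i, (0 : ℝ) < K i := fun i => by rw [hK i]; exact mul_pos (hq i) hM0
  have hqN : ∀ i, 0 < q i * N := fun i => mul_pos (hq i) hN0
  have hqY : ∀ i, 0 < q i * ((M : ℝ) + σ.sgn * N) := fun i => mul_pos (hq i) hY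
  have hK0 : ∀ i, K i ≠ 0 := fun i => by
    have := hKpos i
    exact_mod_cast this.ne'
  have hn0 : ∀ i, n i ≠ 0 := fun i => by
    have : (0 : ℝ) < n i := by linarith [hnpos i, hqN i]
    exact_mod_cast this.ne'
  have hD := fun i => log_distributions (σ := σ) (hK0 i) (hn0 i)
    (by linarith [hypos i, hqY i])
  have hT := log_distributions (σ := σ) hM hN hY
  have hu : 0 < uniformProb σ M N := by
    rw [uniformProb_eq_inv]; exact inv_pos.mpr hT.1
  have hprod : 0 < ∏ i, distributions σ (K i) (n i) := Finset.prod_pos fun i _ => (hD i).1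
  refine ⟨mul_pos hu hprod, ?_⟩
  have hexp := fun i => abs_logDistMain_sub_le (σ := σ) (δ := (n i : ℝ) - N * q i) (hq i) hM0 hN0
    hY (h1 i) (h2 i)
  obtain ⟨-, hG⟩ := log_gaussianLaw hq hM hN hY n
  set Y := (M : ℝ) + σ.sgn * N with hYdef
  set E : Fin r → ℝ := fun i =>
    q i * (σ.sgn * (Y * Real.log Y - M * Real.log M) - N * Real.log N) +
        ((n i : ℝ) - N * q i) * (Real.log Y - Real.log N) -
        ((n i : ℝ) - N * q i) ^ 2 * M / (2 * q i * N * Y) +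
        (Real.log M - Real.log Y - Real.log (2 * Real.pi * N)) / 2 - Real.log (q i) / 2 with hE
  -- Here the bins interact: `∑ q i = 1` cancels the leading part against that of the total count,
  -- and the deviations sum to zero. The `r` half-logarithms of the bins minus the one of the total
  -- give the exponent `(r - 1) / 2`.
  have hsumE : ∑ i, E i - logDistMain σ M N = Real.log (gaussianLaw σ M N q n) := by
    have hδ : ∑ i, ((n i : ℝ) - N * q i) = 0 := by
      rw [Finset.sum_sub_distrib, ← Finset.mul_sum, hq1, ← Nat.cast_sum, hn]; ring
    rw [hG, hE, logDistMain, ← hYdef]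
    simp only [Finset.sum_sub_distrib, Finset.sum_add_distrib] at hδ ⊢
    rw [← Finset.sum_mul, ← Finset.sum_mul, Finset.sum_sub_distrib, hδ, hq1]
    simp only [Finset.sum_const, Finset.card_univ, Fintype.card_fin, nsmul_eq_mul]
    ring
  have hlog : Real.log (uniformProb σ M N * ∏ i, distributions σ (K i) (n i)) =
      ∑ i, Real.log (distributions σ (K i) (n i)) - Real.log (distributions σ M N) := by
    rw [Real.log_mul hu.ne' hprod.ne', uniformProb_eq_inv, Real.log_inv,
      Real.log_prod fun i _ => (hD i).1.ne']
    ring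
  have hterm : ∀ i, |Real.log (distributions σ (K i) (n i)) - E i| ≤
      (1 / (q i * M) + 2 / (q i * N) + 2 / (q i * Y) +
        (4 * (|(n i : ℝ) - N * q i| ^ 3 / (q i * N) ^ 2) +
          4 * (|(n i : ℝ) - N * q i| ^ 3 / (q i * Y) ^ 2) +
          |(n i : ℝ) - N * q i| / (q i * N) + |(n i : ℝ) - N * q i| / (q i * Y))) := by
    intro i
    have a1 := (hD i).2
    have a2 := hexp i
    rw [← hni i, ← hK i] at a2
    have b1 : 1 / (n i : ℝ) ≤ 2 / (q i * N) := by
      rw [div_le_div_iff₀ (by linarith [hnpos i, hqN i]) (hqN i)]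
      linarith [hnpos i]
    have b2 : 1 / ((K i : ℝ) + σ.sgn * n i) ≤ 2 / (q i * Y) := by
      rw [div_le_div_iff₀ (by linarith [hypos i, hqY i]) (hqY i)]
      linarith [hypos i]
    rw [← hK i]
    have := abs_sub_le (Real.log (distributions σ (K i) (n i))) (logDistMain σ (K i) (n i)) (E i)
    linarith
  rw [hlog, ← hsumE]
  clear_value E
  calc _ = |∑ i, (Real.log (distributions σ (K i) (n i)) - E i) -
        (Real.log (distributions σ M N) - logDistMain σ M N)| := by
        rw [Finset.sum_sub_distrib (fun i => Real.log (distributions σ (K i) (n i))) E]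
        congr 1; ring
    _ ≤ ∑ i, |Real.log (distributions σ (K i) (n i)) - E i| +
        |Real.log (distributions σ M N) - logDistMain σ M N| :=
        (abs_sub _ _).trans (add_le_add_left (Finset.abs_sum_le_sum_abs _ _) _)
    _ ≤ _ := by
        rw [add_comm]
        exact add_le_add hT.2 (Finset.sum_le_sum fun i _ => hterm i)

/-- What the error order of the Gaussian law controls. Here `w` is `N / (M ± N)`. -/
theorem errorOrder_bounds {σ : Statistics} {M N : ℕ} {ε : ℝ} (hM : M ≠ 0) (hN : N ≠ 0)
    (hY : 0 < (M : ℝ) + σ.sgn * N) (hε : 0 < ε) (hε' : ε < 1 / 6) :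
    ∃ v : ℝ, 1 ≤ v ∧ (N : ℝ) / ((M : ℝ) + σ.sgn * N) ≤ v ∧
      v ^ 3 * (N : ℝ) ^ (-(3 * ε)) ≤ errorOrder σ M N ε ∧
      1 / (M : ℝ) ≤ errorOrder σ M N ε ∧ 1 / ((M : ℝ) + σ.sgn * N) ≤ errorOrder σ M N ε := by
  have hM0 : (0 : ℝ) < M := by exact_mod_cast Nat.pos_of_ne_zero hM
  have hN0 : (0 : ℝ) < N := by exact_mod_cast Nat.pos_of_ne_zero hN
  have hN1 : (1 : ℝ) ≤ N := by exact_mod_cast Nat.pos_of_ne_zero hN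
  have hpow : 0 < (N : ℝ) ^ (-(3 * ε)) := Real.rpow_pos_of_pos hN0 _
  have h1N : 1 / (N : ℝ) ≤ (N : ℝ) ^ (-(3 * ε)) := by
    rw [one_div, ← Real.rpow_neg_one]
    exact Real.rpow_le_rpow_of_exponent_le hN1 (by linarith)
  cases σ
  · simp only [errorOrder, Statistics.sgn, one_mul] at hY ⊢
    have e1 : density M N / (N : ℝ) = 1 / (M : ℝ) := by
      rw [density]; field_simp
    have e2 : 1 / (N : ℝ) ^ (3 * ε) = (N : ℝ) ^ (-(3 * ε)) := by
      rw [Real.rpow_neg hN0.le, one_div]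
    have hinv : 0 < 1 / (M : ℝ) := by positivity
    have hinv' : 1 / ((M : ℝ) + N) ≤ 1 / (M : ℝ) := one_div_le_one_div_of_le hM0 (by linarith)
    rw [e1, e2]
    -- For bosons `N / (M + N) ≤ 1`. The summand `α / N = 1 / M` of the error order absorbs the
    -- Stirling error of the ports, which may be far fewer than the particles.
    refine ⟨1, le_rfl, ?_, ?_, ?_, ?_⟩
    · rw [div_le_one hY]; linarith
    · linarith
    · linarith
    · linarith
  · simp only [errorOrder, Statistics.sgn, neg_mul, one_mul, ← sub_eq_add_neg] at hY ⊢
    have hα : 1 - density M N = ((M : ℝ) - N) / M := by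
      rw [density]; field_simp
    have hv : 1 ≤ (M : ℝ) / ((M : ℝ) - N) := by
      rw [le_div_iff₀ hY]; linarith
    have e : ((1 - density M N) ^ 3)⁻¹ / (N : ℝ) ^ (3 * ε) =
        ((M : ℝ) / ((M : ℝ) - N)) ^ 3 * (N : ℝ) ^ (-(3 * ε)) := by
      rw [hα, Real.rpow_neg hN0.le, div_eq_mul_inv, ← inv_pow, inv_div]
    have hv3 : 1 ≤ ((M : ℝ) / ((M : ℝ) - N)) ^ 3 := one_le_pow₀ hv
    have hv13 : (M : ℝ) / ((M : ℝ) - N) ≤ ((M : ℝ) / ((M : ℝ) - N)) ^ 3 :=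
      le_self_pow₀ hv (by norm_num)
    have hmul : ∀ x : ℝ, x ≤ ((M : ℝ) / ((M : ℝ) - N)) ^ 3 →
        0 ≤ x → x * (1 / (N : ℝ)) ≤ ((M : ℝ) / ((M : ℝ) - N)) ^ 3 * (N : ℝ) ^ (-(3 * ε)) :=
      fun x hx hx0 => mul_le_mul hx h1N (by positivity) (by positivity)
    have hw : (N : ℝ) / ((M : ℝ) - N) ≤ (M : ℝ) / ((M : ℝ) - N) :=
      div_le_div_of_nonneg_right (by linarith) hY.le
    rw [e]
    -- For fermions `v = 1 / (1 - α)`, whose cube is the prefactor of the error order.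
    refine ⟨(M : ℝ) / ((M : ℝ) - N), hv, hw, le_rfl, ?_, ?_⟩
    · have : 1 / (M : ℝ) ≤ 1 * (1 / (N : ℝ)) := by
        rw [one_mul]; exact one_div_le_one_div_of_le hN0 (by linarith)
      exact this.trans (hmul 1 hv3 zero_le_one)
    · have : 1 / ((M : ℝ) - N) = (N : ℝ) / ((M : ℝ) - N) * (1 / (N : ℝ)) := by field_simp
      rw [this]
      exact hmul _ (hw.trans hv13) (by positivity)

/-- This rests on `|exp d - 1| ≤ |d| * exp |d|`; the bound `B` keeps the exponential a constant. -/
theorem abs_sub_le_of_abs_log_sub_le {x y t B : ℝ} (hx : 0 < x) (hy : 0 < y) (ht : t ≤ B)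
    (h : |Real.log x - Real.log y| ≤ t) : |x - y| ≤ t * Real.exp B * y := by
  set d := Real.log x - Real.log y with hd
  have hxy : x = Real.exp d * y := by
    rw [hd, Real.exp_sub, Real.exp_log hx, Real.exp_log hy]
    field_simp
  have h1 : |Real.exp d - 1| ≤ |d| * Real.exp |d| := by
    rcases le_or_gt 0 d with h0 | h0
    · rw [abs_of_nonneg h0, abs_of_nonneg (by linarith [Real.one_le_exp h0])]
      have h2 := Real.add_one_le_exp (-d)
      have h3 : Real.exp (-d) * Real.exp d = 1 := by rw [← Real.exp_add]; simp
      nlinarith [Real.exp_pos d]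
    · have h2 := Real.add_one_le_exp d
      have h3 : Real.exp d ≤ 1 := Real.exp_le_one_iff.mpr h0.le
      rw [abs_of_nonpos (by linarith), abs_of_neg h0]
      have h4 : 1 ≤ Real.exp (-d) := Real.one_le_exp (by linarith)
      nlinarith
  have h0 : 0 ≤ t := (abs_nonneg d).trans h
  rw [show x - y = (Real.exp d - 1) * y by rw [hxy]; ring, abs_mul, abs_of_pos hy]
  refine mul_le_mul_of_nonneg_right (h1.trans ?_) hy.le
  exact mul_le_mul h (Real.exp_le_exp.mpr (h.trans ht)) (Real.exp_pos _).le h0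

theorem sum_binSize {M r : ℕ} (b : Fin M → Fin r) : ∑ i, binSize b i = M := by
  have := Finset.card_eq_sum_card_fiberwise (f := b) (s := Finset.univ) (t := Finset.univ)
    (by simp)
  simpa [binSize] using this.symm

theorem sum_fraction_eq_one {M r : ℕ} (hM : M ≠ 0) (b : Fin M → Fin r) {q : Fin r → ℝ}
    (hb : ∀ i, (binSize b i : ℝ) / (M : ℝ) = q i) : ∑ i, q i = 1 := by
  have hM0 : (M : ℝ) ≠ 0 := by exact_mod_cast hM
  rw [← Finset.sum_congr rfl fun i _ => hb i, ← Finset.sum_div, ← Nat.cast_sum, sum_binSize,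
    div_self hM0]

theorem abs_binProb_sub_gaussianLaw_le (σ : Statistics) {r : ℕ} {q : Fin r → ℝ} {A ε B : ℝ}
    (hq : ∀ i, 0 < q i) (hA : 0 < A) (hε : 0 < ε) (hε' : ε < 1 / 6) :
    ∃ (C : ℝ) (N₀ : ℕ), ∀ N M : ℕ, N₀ ≤ N → N₀ ≤ M →
      0 < 1 + σ.sgn * density M N → errorOrder σ M N ε ≤ B →
      ∀ K n : Fin r → ℕ, (∀ i, (K i : ℝ) = q i * M) → ∑ i, q i = 1 → ∑ i, n i = N →
        InWindow N q A ε n →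
        |uniformProb σ M N * ∏ i, distributions σ (K i) (n i) - gaussianLaw σ M N q n| ≤
          C * errorOrder σ M N ε * gaussianLaw σ M N q n := by
  -- The `3` and the `5 = 1 + 2 + 2` collect the Stirling errors of the total and of a bin, `8 = 4 +
  -- 4` the cubic remainders, and `2 = 1 + 1` the errors of the half-logarithms.
  set C₁ : ℝ := 3 + ∑ i, (5 / q i + (8 * (A ^ 3 / q i ^ 2) + 2 * (A / q i))) with hC₁
  have hlim : Filter.Tendsto (fun N : ℕ => (N : ℝ) ^ (-(1 / 3 : ℝ))) Filter.atTop (nhds 0) :=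
    (tendsto_rpow_neg_atTop (by norm_num)).comp tendsto_natCast_atTop_atTop
  have hsmall : ∀ᶠ N : ℕ in Filter.atTop,
      ∀ i, A / q i * (1 + |B|) * (N : ℝ) ^ (-(1 / 3 : ℝ)) ≤ 1 / 2 := by
    rw [Filter.eventually_all]
    intro i
    have := hlim.const_mul (A / q i * (1 + |B|))
    rw [mul_zero] at this
    exact this.eventually (Iic_mem_nhds (by norm_num))
  obtain ⟨N₁, hN₁⟩ := Filter.eventually_atTop.mp hsmall
  refine ⟨C₁ * Real.exp (C₁ * |B|), max N₁ 1, ?_⟩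
  intro N M hN' hM' hpos hEB K n hK hq1 hn hwin
  have hN : N ≠ 0 := by have := le_trans (le_max_right _ _) hN'; omega
  have hM : M ≠ 0 := by have := le_trans (le_max_right _ _) hM'; omega
  have hsm := hN₁ N (le_trans (le_max_left _ _) hN')
  have hM0 : (0 : ℝ) < M := by exact_mod_cast Nat.pos_of_ne_zero hM
  have hN0 : (0 : ℝ) < N := by exact_mod_cast Nat.pos_of_ne_zero hN
  have hN1 : (1 : ℝ) ≤ N := by exact_mod_cast Nat.pos_of_ne_zero hN
  have hY : 0 < (M : ℝ) + σ.sgn * N := by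
    rw [one_add_sgn_mul_density hM] at hpos
    exact (div_pos_iff_of_pos_right hM0).mp hpos
  obtain ⟨v, hv1, hwv, hvE, hME, hYE⟩ := errorOrder_bounds hM hN hY hε hε'
  obtain ⟨hGpos, -⟩ := log_gaussianLaw hq hM hN hY n
  set E := errorOrder σ M N ε with hEdef
  set Y := (M : ℝ) + σ.sgn * N with hYdef
  set w := (N : ℝ) / Y with hw
  have hw0 : 0 < w := div_pos hN0 hY
  have hYw : Y = N / w := by rw [hw]; field_simp
  set p := (N : ℝ) ^ (-(3 * ε)) with hp
  have hp0 : 0 < p := Real.rpow_pos_of_pos hN0 _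
  -- The relative deviation at the edge of the window, up to `A`; the cubic remainder is `N * z ^ 3
  -- = N ^ (-3 * ε)`.
  set z := (N : ℝ) ^ (-(1 / 3) - ε) with hz
  have hz0 : 0 < z := Real.rpow_pos_of_pos hN0 _
  have hzp : z ≤ p := Real.rpow_le_rpow_of_exponent_le hN1 (by linarith)
  have hz3 : N * z ^ 3 = p := by
    rw [hz, hp, ← Real.rpow_natCast, ← Real.rpow_mul hN0.le]
    nth_rewrite 1 [← Real.rpow_one (N : ℝ)]
    rw [← Real.rpow_add hN0]
    congr 1
    push_cast
    ring
  have hB0 : 0 ≤ |B| := abs_nonneg B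
  have hE0 : 0 < E := lt_of_lt_of_le (by positivity) hME
  have hEB' : E ≤ |B| := hEB.trans (le_abs_self B)
  -- The bound on the error order makes `v * N ^ (-ε)` bounded. The spare factor `N ^ (-1/3)` then
  -- forces deviations below half of both `q i * N` and `q i * (M ± N)`, even as fermions approach
  -- full filling.
  have hvz : v * z ≤ (1 + |B|) * (N : ℝ) ^ (-(1 / 3 : ℝ)) := by
    have e : z = (N : ℝ) ^ (-ε) * (N : ℝ) ^ (-(1 / 3 : ℝ)) := by
      rw [hz, ← Real.rpow_add hN0]; congr 1; ring
    have e3 : ((N : ℝ) ^ (-ε)) ^ 3 = p := by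
      rw [hp, ← Real.rpow_natCast, ← Real.rpow_mul hN0.le]; congr 1; push_cast; ring
    have hle : v * (N : ℝ) ^ (-ε) ≤ 1 + |B| := by
      have h3 : (v * (N : ℝ) ^ (-ε)) ^ 3 ≤ (1 + |B|) ^ 3 := by
        rw [mul_pow, e3]
        have : 1 + |B| ≤ (1 + |B|) ^ 3 := le_self_pow₀ (by linarith) (by norm_num)
        linarith
      exact le_of_pow_le_pow_left₀ (by norm_num) (by positivity) h3
    rw [e, ← mul_assoc]
    exact mul_le_mul_of_nonneg_right hle (Real.rpow_nonneg hN0.le _)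
  have hvE1 : v * p ≤ E := by
    refine le_trans (mul_le_mul_of_nonneg_right ?_ hp0.le) hvE
    exact le_self_pow₀ hv1 (by norm_num)
  have hpE : p ≤ E := by nlinarith
  have hw2E : w ^ 2 * p ≤ E := by
    refine le_trans (mul_le_mul_of_nonneg_right ?_ hp0.le) hvE
    calc w ^ 2 ≤ v ^ 2 := pow_le_pow_left₀ hw0.le hwv 2
      _ ≤ v ^ 3 := pow_le_pow_right₀ hv1 (by norm_num)
  have hNE : 1 / (N : ℝ) ≤ E := by
    refine le_trans ?_ hpE
    rw [hp, one_div, ← Real.rpow_neg_one]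
    exact Real.rpow_le_rpow_of_exponent_le hN1 (by linarith)
  have hδ : ∀ i, |(n i : ℝ) - N * q i| ≤ A * (N * z) := by
    intro i
    refine (hwin i).trans_eq ?_
    congr 1
    rw [hz]
    nth_rewrite 2 [← Real.rpow_one (N : ℝ)]
    rw [← Real.rpow_add hN0]
    congr 1
    ring
  have hvz2 : ∀ i, A * (v * z) ≤ q i / 2 := by
    intro i
    have h := hsm i
    have hqi := hq i
    have h' : A * ((1 + |B|) * (N : ℝ) ^ (-(1 / 3 : ℝ))) =
        q i * (A / q i * (1 + |B|) * (N : ℝ) ^ (-(1 / 3 : ℝ))) := by field_simp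
    calc A * (v * z) ≤ A * ((1 + |B|) * (N : ℝ) ^ (-(1 / 3 : ℝ))) :=
          mul_le_mul_of_nonneg_left hvz hA.le
      _ ≤ q i * (1 / 2) := by rw [h']; exact mul_le_mul_of_nonneg_left h hqi.le
      _ = q i / 2 := by ring
  have hwz : w * z ≤ v * z := mul_le_mul_of_nonneg_right hwv hz0.le
  have h1z : z ≤ v * z := by nlinarith
  have h1 : ∀ i, |(n i : ℝ) - N * q i| ≤ q i * N / 2 := by
    intro i
    have := hvz2 i
    calc _ ≤ A * (N * z) := hδ i
      _ = N * (A * z) := by ring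
      _ ≤ N * (A * (v * z)) := by gcongr
      _ ≤ N * (q i / 2) := by gcongr
      _ = q i * N / 2 := by ring
  have h2 : ∀ i, |(n i : ℝ) - N * q i| ≤ q i * Y / 2 := by
    intro i
    have := hvz2 i
    have e : A * (N * z) = Y * (A * (w * z)) := by rw [hw]; field_simp
    calc _ ≤ A * (N * z) := hδ i
      _ = Y * (A * (w * z)) := e
      _ ≤ Y * (A * (v * z)) := by gcongr
      _ ≤ Y * (q i / 2) := by gcongr
      _ = q i * Y / 2 := by ring
  obtain ⟨hPpos, hlog⟩ := abs_log_binProb_sub_log_gaussianLaw_le hq hq1 hM hN hY hK hn h1 h2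
  have hbound : |Real.log (uniformProb σ M N * ∏ i, distributions σ (K i) (n i)) -
        Real.log (gaussianLaw σ M N q n)| ≤ C₁ * E := by
    refine hlog.trans ?_
    rw [hC₁, add_mul, Finset.sum_mul]
    refine add_le_add (by linarith) (Finset.sum_le_sum fun i _ => ?_)
    have hqi := hq i
    have b1 : 1 / (q i * M) ≤ 1 / q i * E := by
      rw [one_div_mul_eq_div, ← div_div, div_right_comm]
      exact div_le_div_of_nonneg_right hME hqi.le
    have b2 : 2 / (q i * N) ≤ 2 / q i * E := by
      have : 2 / (q i * N) = 2 / q i * (1 / N) := by field_simp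
      rw [this]; gcongr
    have b3 : 2 / (q i * Y) ≤ 2 / q i * E := by
      have : 2 / (q i * Y) = 2 / q i * (1 / Y) := by field_simp
      rw [this]; gcongr
    have hδ3 : |(n i : ℝ) - N * q i| ^ 3 ≤ (A * (N * z)) ^ 3 :=
      pow_le_pow_left₀ (abs_nonneg _) (hδ i) 3
    have b4 : |(n i : ℝ) - N * q i| ^ 3 / (q i * N) ^ 2 ≤ A ^ 3 / q i ^ 2 * E := by
      calc _ ≤ (A * (N * z)) ^ 3 / (q i * N) ^ 2 := by gcongr
        _ = A ^ 3 / q i ^ 2 * p := by rw [← hz3]; field_simp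
        _ ≤ _ := by gcongr
    have b5 : |(n i : ℝ) - N * q i| ^ 3 / (q i * Y) ^ 2 ≤ A ^ 3 / q i ^ 2 * E := by
      calc _ ≤ (A * (N * z)) ^ 3 / (q i * Y) ^ 2 := by gcongr
        _ = A ^ 3 / q i ^ 2 * (w ^ 2 * p) := by rw [← hz3, hw]; field_simp
        _ ≤ _ := by gcongr
    have b6 : |(n i : ℝ) - N * q i| / (q i * N) ≤ A / q i * E := by
      calc _ ≤ (A * (N * z)) / (q i * N) := by gcongr; exact hδ i
        _ = A / q i * z := by field_simp
        _ ≤ _ := by gcongr; exact hzp.trans hpE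
    have b7 : |(n i : ℝ) - N * q i| / (q i * Y) ≤ A / q i * E := by
      calc _ ≤ (A * (N * z)) / (q i * Y) := by gcongr; exact hδ i
        _ = A / q i * (w * z) := by rw [hw]; field_simp
        _ ≤ A / q i * (v * p) := by gcongr
        _ ≤ _ := by gcongr
    have e : (5 / q i + (8 * (A ^ 3 / q i ^ 2) + 2 * (A / q i))) * E =
        1 / q i * E + 2 / q i * E + 2 / q i * E + (4 * (A ^ 3 / q i ^ 2 * E) +
          4 * (A ^ 3 / q i ^ 2 * E) + A / q i * E + A / q i * E) := by ring
    rw [e]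
    gcongr
  have hC₁0 : 0 ≤ C₁ := by
    refine add_nonneg (by norm_num) (Finset.sum_nonneg fun i _ => ?_)
    have := hq i
    positivity
  have := abs_sub_le_of_abs_log_sub_le hPpos hGpos
    (mul_le_mul_of_nonneg_left hEB' hC₁0) hbound
  refine this.trans_eq ?_
  ring

end GaussianLaw

/-! ### The tail bound by exponential tilting -/

section Tail

/-- A single term of the negative binomial series, whose terms are nonnegative. -/
theorem multichoose_mul_pow_le {K n : ℕ} (hK : K ≠ 0) {z : ℝ} (h0 : 0 ≤ z) (h1 : z < 1) :
    (K.multichoose n : ℝ) * z ^ n ≤ 1 / (1 - z) ^ K := by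
  obtain ⟨k, rfl⟩ := Nat.exists_eq_succ_of_ne_zero hK
  have h := hasSum_choose_mul_geometric_of_norm_lt_one k (r := z)
    (by rwa [Real.norm_eq_abs, abs_of_nonneg h0])
  have h2 := le_hasSum h n fun m _ => by positivity
  have e : (k.succ).multichoose n = (n + k).choose k := by
    rw [Nat.multichoose_eq, show k.succ + n - 1 = k + n by omega, add_comm n k,
      ← Nat.choose_symm_add]
  rw [e]
  exact h2

theorem choose_mul_pow_le (K n : ℕ) {z : ℝ} (h0 : 0 ≤ z) :
    (K.choose n : ℝ) * z ^ n ≤ (1 + z) ^ K := by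
  rcases le_or_gt n K with h | h
  · rw [add_comm, add_pow]
    refine le_trans (le_of_eq ?_) (Finset.single_le_sum (f := fun m =>
      z ^ m * 1 ^ (K - m) * (K.choose m : ℝ)) (fun m _ => by positivity)
      (Finset.mem_range.mpr (Nat.lt_succ_of_le h)))
    ring
  · rw [Nat.choose_eq_zero_of_lt h]
    simp only [Nat.cast_zero, zero_mul]
    positivity

/-- A bound by the generating function. -/
theorem distributions_le_exp {σ : Statistics} {K n : ℕ} (hK : K ≠ 0) {y : ℝ} (hy : 0 < y)
    (hy' : 0 < 1 + σ.sgn * y) :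
    distributions σ K n ≤ Real.exp (n * (Real.log (1 + σ.sgn * y) - Real.log y) +
      σ.sgn * K * Real.log (1 + σ.sgn * y)) := by
  -- At this argument the generating function `(1 - σz) ^ (-σK)` has mean occupation `y` per port,
  -- so `y` has the meaning of a density and the bound is best at `y = n / K`.
  have hz : 0 < y / (1 + σ.sgn * y) := div_pos hy hy'
  have e : Real.exp (n * (Real.log (1 + σ.sgn * y) - Real.log y)) =
      ((y / (1 + σ.sgn * y)) ^ n)⁻¹ := by
    rw [← Real.log_div hy'.ne' hy.ne', Real.exp_nat_mul, Real.exp_log (div_pos hy' hy),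
      ← inv_pow, inv_div]
  rw [Real.exp_add, e, inv_mul_eq_div, le_div_iff₀ (pow_pos hz n)]
  cases σ
  · simp only [Statistics.sgn, one_mul] at hy' hz ⊢
    rw [Real.exp_nat_mul, Real.exp_log hy', distributions_boson]
    refine (multichoose_mul_pow_le hK hz.le ?_).trans_eq ?_
    · rw [div_lt_one hy']; linarith
    · have : 1 - y / (1 + y) = (1 + y)⁻¹ := by field_simp; ring
      rw [this, inv_pow, one_div, inv_inv]
  · simp only [Statistics.sgn, neg_mul, one_mul] at hy' hz ⊢
    rw [Real.exp_neg, Real.exp_nat_mul, Real.exp_log hy', distributions_fermion]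
    refine (choose_mul_pow_le K n hz.le).trans_eq ?_
    have : 1 + y / (1 + -y) = (1 + -y)⁻¹ := by field_simp; ring
    rw [this, inv_pow]

variable {σ : Statistics} {α : ℝ}

/-- Exponential tilting: a bound on the bin probability with one parameter for each bin, where
`t = 0` is the uniform density `α`. -/
theorem binProb_le_exp (hα : 0 < α) (hσα : 0 < 1 + σ.sgn * α) {r M N : ℕ} (hM : M ≠ 0)
    (hN : N ≠ 0) (hd : density M N = α) {K n : Fin r → ℕ} (hK : ∀ i, K i ≠ 0)
    (hKM : ∑ i, K i = M) (hn : ∑ i, n i = N) (t : Fin r → ℝ) (ht : ∀ i, 0 < 1 + t i)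
    (ht' : ∀ i, 0 < 1 + σ.sgn * α / (1 + σ.sgn * α) * t i) :
    uniformProb σ M N * ∏ i, distributions σ (K i) (n i) ≤
      Real.exp (Real.log N / 2 + (|Real.log (1 + σ.sgn * α)| + Real.log (2 * Real.pi) + 2 +
        1 / (1 + σ.sgn * α)) +
        ∑ i, ((n i : ℝ) * (Real.log (1 + σ.sgn * α / (1 + σ.sgn * α) * t i) -
            Real.log (1 + t i)) +
          σ.sgn * K i * Real.log (1 + σ.sgn * α / (1 + σ.sgn * α) * t i))) := by
  have hM0 : (0 : ℝ) < M := by exact_mod_cast Nat.pos_of_ne_zero hM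
  have hN0 : (0 : ℝ) < N := by exact_mod_cast Nat.pos_of_ne_zero hN
  have hM1 : (1 : ℝ) ≤ M := by exact_mod_cast Nat.pos_of_ne_zero hM
  have hN1 : (1 : ℝ) ≤ N := by exact_mod_cast Nat.pos_of_ne_zero hN
  have hss := σ.sgn_mul_sgn
  have hNM : (N : ℝ) = α * M := by rw [← hd, density]; field_simp
  have hYM : (M : ℝ) + σ.sgn * N = (1 + σ.sgn * α) * M := by rw [hNM]; ring
  have hY : 0 < (M : ℝ) + σ.sgn * N := by rw [hYM]; positivity
  obtain ⟨hTpos, hT⟩ := log_distributions (σ := σ) hM hN hY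
  set s := σ.sgn with hs
  set g := 1 + s * α with hg
  set β := s * α / g with hβ
  -- Stirling's formula is needed only here, for the total count; it is the source of the factor
  -- `√N`.
  have hu : uniformProb σ M N ≤ Real.exp (N * Real.log α - (N + s * M) * Real.log g +
      Real.log N / 2 + (|Real.log g| + Real.log (2 * Real.pi) + 2 + 1 / g)) := by
    rw [uniformProb_eq_inv, ← Real.exp_log (inv_pos.mpr hTpos), Real.log_inv]
    refine Real.exp_le_exp.mpr ?_
    have h1 := (abs_le.mp hT).1
    have lN : Real.log N = Real.log α + Real.log M := by rw [hNM, Real.log_mul hα.ne' hM0.ne']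
    have lY : Real.log ((M : ℝ) + s * N) = Real.log g + Real.log M := by
      rw [hYM, Real.log_mul hσα.ne' hM0.ne']
    have l2 : Real.log (2 * Real.pi * N) = Real.log (2 * Real.pi) + Real.log N :=
      Real.log_mul (by positivity) hN0.ne'
    have l2π : 0 ≤ Real.log (2 * Real.pi) :=
      Real.log_nonneg (by linarith [Real.pi_gt_three])
    have i1 : 1 / (M : ℝ) ≤ 1 := by rw [div_le_one hM0]; exact hM1
    have i2 : 1 / (N : ℝ) ≤ 1 := by rw [div_le_one hN0]; exact hN1
    have i3 : 1 / ((M : ℝ) + s * N) ≤ 1 / g := by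
      rw [hYM]
      exact one_div_le_one_div_of_le hσα (by nlinarith)
    have key : logDistMain σ M N = (N + s * M) * Real.log g - N * Real.log α -
        (Real.log g + Real.log (2 * Real.pi) + Real.log N) / 2 := by
      rw [logDistMain, ← hs, lY, l2, lN]
      linear_combination (N * (Real.log g + Real.log M)) * hss
    rw [key] at h1
    linarith [le_abs_self (Real.log g), abs_nonneg (Real.log g)]
  have hD : ∀ i, distributions σ (K i) (n i) ≤
      Real.exp (-(n i : ℝ) * Real.log α + (n i + s * K i) * Real.log g +
        ((n i : ℝ) * (Real.log (1 + β * t i) - Real.log (1 + t i)) +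
          s * K i * Real.log (1 + β * t i))) := by
    intro i
    -- The bin is evaluated at density `α (1 + t i)`; the factorization splits off the uniform part,
    -- which cancels against `hu` after summation over the bins.
    have e : 1 + s * (α * (1 + t i)) = g * (1 + β * t i) := by
      rw [hβ]; field_simp; rw [hg]; ring
    have hpos : 0 < 1 + s * (α * (1 + t i)) := by rw [e]; exact mul_pos hσα (ht' i)
    refine (distributions_le_exp (σ := σ) (n := n i) (hK i) (mul_pos hα (ht i)) hpos).trans_eq ?_
    rw [← hs, e, Real.log_mul hσα.ne' (ht' i).ne', Real.log_mul hα.ne' (ht i).ne']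
    congr 1
    ring
  have hDnn : ∀ i, 0 ≤ distributions σ (K i) (n i) := by
    intro i
    cases σ
    · rw [distributions_boson]; positivity
    · rw [distributions_fermion]; positivity
  have hprod : ∏ i, distributions σ (K i) (n i) ≤
      Real.exp (∑ i, (-(n i : ℝ) * Real.log α + (n i + s * K i) * Real.log g +
        ((n i : ℝ) * (Real.log (1 + β * t i) - Real.log (1 + t i)) +
          s * K i * Real.log (1 + β * t i)))) := by
    rw [Real.exp_sum]
    exact Finset.prod_le_prod (fun i _ => hDnn i) fun i _ => hD i
  refine (mul_le_mul hu hprod (Finset.prod_nonneg fun i _ => hDnn i)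
    (Real.exp_pos _).le).trans_eq ?_
  rw [← Real.exp_add]
  congr 1
  have hnR : ∑ i, (n i : ℝ) = N := by exact_mod_cast hn
  have hKR : ∑ i, (K i : ℝ) = M := by exact_mod_cast hKM
  rw [Finset.sum_add_distrib, Finset.sum_add_distrib, ← Finset.sum_mul, ← Finset.sum_mul,
    Finset.sum_add_distrib, Finset.sum_neg_distrib, ← Finset.mul_sum, hnR, hKR]
  ring

theorem abs_log_one_add_sub_self_le {u : ℝ} (hu : |u| ≤ 1 / 2) :
    |Real.log (1 + u) - u| ≤ 2 * u ^ 2 := by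
  have h := abs_log_one_add_sub_le hu
  have h1 : Real.log (1 + u) - u = (Real.log (1 + u) - (u - u ^ 2 / 2)) - u ^ 2 / 2 := by ring
  rw [h1]
  refine (abs_sub _ _).trans ?_
  have h2 : |u ^ 2 / 2| = u ^ 2 / 2 := abs_of_nonneg (by positivity)
  have h3 : |u| ^ 3 ≤ 1 / 2 * u ^ 2 := by
    rw [pow_succ', ← sq_abs u]
    exact mul_le_mul_of_nonneg_right hu (by positivity)
  rw [h2]
  linarith [sq_nonneg u]

/-- The exponent of a tilted bin at its mean count. -/
theorem mean_exponent_le {s α q M N t : ℝ} (hs : s * s = 1) (hα : 0 < α) (hg : 0 < 1 + s * α)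
    (hq : 0 ≤ q) (hM : 0 < M) (hN : N = α * M) (ht : |t| ≤ 1 / 2)
    (ht' : |s * α / (1 + s * α) * t| ≤ 1 / 2) :
    q * N * (Real.log (1 + s * α / (1 + s * α) * t) - Real.log (1 + t)) +
      s * (q * M) * Real.log (1 + s * α / (1 + s * α) * t) ≤
    1 / (1 + s * α) * (q * N * t ^ 2) / 2 +
      (2 + 2 * ((1 + s * α) / α * |s * α / (1 + s * α)| ^ 3)) * (q * N * |t| ^ 3) := by
  set β := s * α / (1 + s * α) with hβ
  have hs1 : |s| = 1 := by
    have : |s| * |s| = 1 := by rw [← abs_mul, hs, abs_one]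
    nlinarith [abs_nonneg s]
  have h1 := abs_le.mp (abs_log_one_add_sub_le ht)
  have h2 := abs_log_one_add_sub_le ht'
  have hY0 : 0 < (1 + s * α) * M := mul_pos hg hM
  have h2' : |s * (q * ((1 + s * α) * M)) * (Real.log (1 + β * t) - (β * t - (β * t) ^ 2 / 2))| ≤
      q * ((1 + s * α) * M) * (2 * (|β| ^ 3 * |t| ^ 3)) := by
    rw [abs_mul, abs_mul, hs1, one_mul, abs_of_nonneg (mul_nonneg hq hY0.le), ← mul_pow, ← abs_mul]
    exact mul_le_mul_of_nonneg_left h2 (mul_nonneg hq hY0.le)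
  replace h2' := (abs_le.mp h2').2
  have hqN : 0 ≤ q * N := mul_nonneg hq (by rw [hN]; positivity)
  have h1' := mul_le_mul_of_nonneg_left h1.1 hqN
  have hβY : s * (q * ((1 + s * α) * M)) * β = q * N := by
    rw [hβ, hN]; field_simp; linear_combination q * hs
  have hκ : 1 / (1 + s * α) = 1 - β := by rw [hβ]; field_simp; ring
  have e1 : (1 + s * α) / α * (q * N) = q * ((1 + s * α) * M) := by
    rw [hN]; field_simp
  have e2 : q * N + s * (q * M) = s * (q * ((1 + s * α) * M)) := by
    rw [hN]; linear_combination (-q * M * α) * hs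
  have e3 : (2 + 2 * ((1 + s * α) / α * |β| ^ 3)) * (q * N * |t| ^ 3) =
      2 * (q * N) * |t| ^ 3 + q * ((1 + s * α) * M) * (2 * (|β| ^ 3 * |t| ^ 3)) := by
    rw [← e1]; ring
  rw [e3, hκ]
  have e4 : q * N * (Real.log (1 + β * t) - Real.log (1 + t)) +
      s * (q * M) * Real.log (1 + β * t) =
      s * (q * ((1 + s * α) * M)) * Real.log (1 + β * t) - q * N * Real.log (1 + t) := by
    rw [← e2]; ring
  rw [e4]
  have e5 : s * (q * ((1 + s * α) * M)) * (Real.log (1 + β * t) - (β * t - (β * t) ^ 2 / 2)) =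
      s * (q * ((1 + s * α) * M)) * Real.log (1 + β * t) -
        (q * N * t - q * N * (β * t ^ 2) / 2) := by
    rw [← hβY]; ring
  rw [e5] at h2'
  linarith

/-- The slope `β - 1 = -1 / (1 + sα)` of the tilt per particle, with `β = sα / (1 + sα)`, is what
makes a deviation from the mean pay. -/
theorem abs_tilt_add_le {s α t : ℝ} (hg : 0 < 1 + s * α) (ht : |t| ≤ 1 / 2)
    (ht' : |s * α / (1 + s * α) * t| ≤ 1 / 2) :
    |Real.log (1 + s * α / (1 + s * α) * t) - Real.log (1 + t) + 1 / (1 + s * α) * t| ≤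
      (2 + 2 * (s * α / (1 + s * α)) ^ 2) * t ^ 2 := by
  have h1 := abs_le.mp (abs_log_one_add_sub_self_le ht)
  have h2 := abs_le.mp (abs_log_one_add_sub_self_le ht')
  have hκ : 1 / (1 + s * α) = 1 - s * α / (1 + s * α) := by field_simp; ring
  rw [hκ, abs_le]
  constructor <;> linarith [h1.1, h1.2, h2.1, h2.2]

/-- As `1 - β = 1 / (1 + sα)` is positive, the tilt per particle has the sign opposite to `t`. A
deviation exceeding the one tilted for therefore only lowers the exponent. -/
theorem mul_tilt_nonpos {s α t c : ℝ} (hg : 0 < 1 + s * α) (ht : |t| ≤ 1 / 2)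
    (ht' : |s * α / (1 + s * α) * t| ≤ 1 / 2) (hc : 0 ≤ c * t) :
    c * (Real.log (1 + s * α / (1 + s * α) * t) - Real.log (1 + t)) ≤ 0 := by
  have p1 : 0 < 1 + t := by linarith [(abs_le.mp ht).1]
  have p2 : 0 < 1 + s * α / (1 + s * α) * t := by linarith [(abs_le.mp ht').1]
  have hκ : s * α / (1 + s * α) = 1 - 1 / (1 + s * α) := by field_simp; ring
  have hκ0 : 0 < 1 / (1 + s * α) := by positivity
  rcases lt_trichotomy t 0 with h | h | h
  · have hc' : c ≤ 0 := by nlinarith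
    refine mul_nonpos_of_nonpos_of_nonneg hc' (sub_nonneg.mpr (Real.log_le_log p1 ?_))
    rw [hκ]; nlinarith
  · simp [h]
  · have hc' : 0 ≤ c := by nlinarith
    refine mul_nonpos_of_nonneg_of_nonpos hc' (sub_nonpos.mpr (Real.log_le_log p2 ?_))
    rw [hκ]; nlinarith

/-- The constant in `two_bin_exponent_le`. -/
noncomputable def tiltConst (s α q : ℝ) : ℝ :=
  (4 + 2 * ((1 + s * α) / α * |s * α / (1 + s * α)| ^ 3) + 2 * (s * α / (1 + s * α)) ^ 2) *
    (1 / q ^ 2 + 1 / (1 - q) ^ 2)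

/-- The exponent for two bins, tilted for the deviation `d` when the actual deviation is at least
as large. -/
theorem two_bin_exponent_le {s α q M N d δ : ℝ} (hs : s * s = 1) (hα : 0 < α)
    (hg : 0 < 1 + s * α) (hq : 0 < q) (hq1 : q < 1) (hM : 0 < M) (hN : N = α * M)
    (ht : |d / (q * N)| ≤ 1 / 2) (hβt : |s * α / (1 + s * α) * (d / (q * N))| ≤ 1 / 2)
    (ht' : |-d / ((1 - q) * N)| ≤ 1 / 2)
    (hβt' : |s * α / (1 + s * α) * (-d / ((1 - q) * N))| ≤ 1 / 2)
    (hδ : 0 ≤ (δ - d) * d) :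
    ((q * N + δ) * (Real.log (1 + s * α / (1 + s * α) * (d / (q * N))) -
        Real.log (1 + d / (q * N))) +
      s * (q * M) * Real.log (1 + s * α / (1 + s * α) * (d / (q * N)))) +
    (((1 - q) * N - δ) * (Real.log (1 + s * α / (1 + s * α) * (-d / ((1 - q) * N))) -
        Real.log (1 + -d / ((1 - q) * N))) +
      s * ((1 - q) * M) * Real.log (1 + s * α / (1 + s * α) * (-d / ((1 - q) * N)))) ≤
    -(1 / (1 + s * α) * (d ^ 2 / N)) + tiltConst s α q * (|d| ^ 3 / N ^ 2) := by
  have hN0 : 0 < N := by rw [hN]; positivity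
  have hq' : 0 < 1 - q := by linarith
  have m1 := mean_exponent_le hs hα hg hq.le hM hN ht hβt
  have m2 := mean_exponent_le hs hα hg hq'.le hM hN ht' hβt'
  have a1 := abs_tilt_add_le hg ht hβt
  have a2 := abs_tilt_add_le hg ht' hβt'
  have n1 := mul_tilt_nonpos (c := δ - d) hg ht hβt (by
    rw [← mul_div_assoc]; exact div_nonneg hδ (by positivity))
  have n2 := mul_tilt_nonpos (c := -(δ - d)) hg ht' hβt' (by
    rw [← mul_div_assoc, neg_mul_neg]; exact div_nonneg hδ (by positivity))
  rw [tiltConst]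
  set β := s * α / (1 + s * α) with hβ
  set κ := 1 / (1 + s * α) with hκ
  have hκ0 : 0 < κ := by rw [hκ]; positivity
  set ℓ := Real.log (1 + β * (d / (q * N))) - Real.log (1 + d / (q * N)) with hℓ
  set ℓ' := Real.log (1 + β * (-d / ((1 - q) * N))) - Real.log (1 + -d / ((1 - q) * N)) with hℓ'
  clear_value β κ ℓ ℓ'
  have b1 : d * (ℓ + κ * (d / (q * N))) ≤ (2 + 2 * β ^ 2) * (|d| ^ 3 / (q ^ 2 * N ^ 2)) := by
    refine (le_abs_self _).trans ?_
    rw [abs_mul]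
    refine (mul_le_mul_of_nonneg_left a1 (abs_nonneg d)).trans_eq ?_
    have e : (d / (q * N)) ^ 2 = |d| ^ 2 / (q * N) ^ 2 := by rw [div_pow, sq_abs]
    rw [e]
    field_simp
  have b2 : -d * (ℓ' + κ * (-d / ((1 - q) * N))) ≤
      (2 + 2 * β ^ 2) * (|d| ^ 3 / ((1 - q) ^ 2 * N ^ 2)) := by
    refine (le_abs_self _).trans ?_
    rw [abs_mul, abs_neg]
    refine (mul_le_mul_of_nonneg_left a2 (abs_nonneg d)).trans_eq ?_
    have e : (-d / ((1 - q) * N)) ^ 2 = |d| ^ 2 / ((1 - q) * N) ^ 2 := by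
      rw [div_pow, neg_sq, sq_abs]
    rw [e]
    field_simp
  have c1 : q * N * (d / (q * N)) ^ 2 = d ^ 2 / N * (1 / q) := by field_simp
  have c2 : (1 - q) * N * (-d / ((1 - q) * N)) ^ 2 = d ^ 2 / N * (1 / (1 - q)) := by field_simp
  have c3 : q * N * |d / (q * N)| ^ 3 = |d| ^ 3 / N ^ 2 * (1 / q ^ 2) := by
    rw [abs_div, abs_of_pos (mul_pos hq hN0)]; field_simp
  have c4 : (1 - q) * N * |-d / ((1 - q) * N)| ^ 3 = |d| ^ 3 / N ^ 2 * (1 / (1 - q) ^ 2) := by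
    rw [abs_div, abs_neg, abs_of_pos (mul_pos hq' hN0)]; field_simp
  have c5 : d * (κ * (d / (q * N))) = κ * (d ^ 2 / N * (1 / q)) := by field_simp
  have c6 : -d * (κ * (-d / ((1 - q) * N))) = κ * (d ^ 2 / N * (1 / (1 - q))) := by field_simp
  have c7 : |d| ^ 3 / (q ^ 2 * N ^ 2) = |d| ^ 3 / N ^ 2 * (1 / q ^ 2) := by field_simp
  have c8 : |d| ^ 3 / ((1 - q) ^ 2 * N ^ 2) = |d| ^ 3 / N ^ 2 * (1 / (1 - q) ^ 2) := by field_simp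
  rw [c1, c3] at m1
  rw [c2, c4] at m2
  rw [mul_add, c5, c7] at b1
  rw [mul_add, c6, c8] at b2
  -- The gain is `κ (d² / N) (1 / q + 1 / (1 - q)) / 2`: the linear terms give twice what the mean
  -- exponents cost. The value `2`, rather than the optimal `4`, suffices for the claimed rate.
  have hfour : 2 ≤ 1 / q + 1 / (1 - q) := by
    have h1 : 1 ≤ 1 / q := by rw [le_div_iff₀ hq]; linarith
    have h2 : 1 ≤ 1 / (1 - q) := by rw [le_div_iff₀ hq']; linarith
    linarith
  have hmain : κ * (d ^ 2 / N) * 2 ≤ κ * (d ^ 2 / N) * (1 / q + 1 / (1 - q)) :=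
    mul_le_mul_of_nonneg_left hfour (by positivity)
  linarith [m1, m2, b1, b2, n1, n2, hmain]

theorem binProb_le_of_not_inWindow (σ : Statistics) {r : ℕ} {q : Fin r → ℝ} {A ε α : ℝ}
    (hq : ∀ i, 0 < q i) (hA : 0 < A) (hε : 0 < ε) (hα : 0 < α)
    (hσα : 0 < 1 + σ.sgn * α) :
    ∃ (C : ℝ) (N₀ : ℕ), ∀ N M : ℕ, N₀ ≤ N → N₀ ≤ M → density M N = α →
      ∀ K n : Fin r → ℕ, (∀ i, (K i : ℝ) = q i * M) → ∑ i, K i = M → ∑ i, q i = 1 →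
        ∑ i, n i = N → ¬ InWindow N q A ε n →
        uniformProb σ M N * ∏ i, distributions σ (K i) (n i) ≤
          C * ((N : ℝ) ^ tailPower σ *
            Real.exp (-(A ^ 2 / (1 + σ.sgn * α)) * (N : ℝ) ^ (1 / 3 - 2 * ε))) := by
  have hss := σ.sgn_mul_sgn
  set s := σ.sgn with hs
  set β := s * α / (1 + s * α) with hβ
  have hlim : Filter.Tendsto (fun N : ℕ => (N : ℝ) ^ (-(1 / 3 + ε))) Filter.atTop (nhds 0) :=
    (tendsto_rpow_neg_atTop (by linarith)).comp tendsto_natCast_atTop_atTop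
  have hsmall : ∀ᶠ N : ℕ in Filter.atTop, ∀ i, (1 + |β|) * A * (1 / q i + 1 / (1 - q i)) *
      (N : ℝ) ^ (-(1 / 3 + ε)) ≤ 1 / 2 := by
    rw [Filter.eventually_all]
    intro i
    have := hlim.const_mul ((1 + |β|) * A * (1 / q i + 1 / (1 - q i)))
    rw [mul_zero] at this
    exact this.eventually (Iic_mem_nhds (by norm_num))
  obtain ⟨N₁, hN₁⟩ := Filter.eventually_atTop.mp hsmall
  set C₀ := |Real.log (1 + s * α)| + Real.log (2 * Real.pi) + 2 + 1 / (1 + s * α) with hC₀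
  refine ⟨Real.exp (C₀ + ∑ i, |tiltConst s α (q i)| * A ^ 3), max N₁ 1, ?_⟩
  intro N M hN' hM' hd K n hK hKM hq1 hn hwin
  have hN : N ≠ 0 := by have := le_trans (le_max_right _ _) hN'; omega
  have hM : M ≠ 0 := by have := le_trans (le_max_right _ _) hM'; omega
  have hM0 : (0 : ℝ) < M := by exact_mod_cast Nat.pos_of_ne_zero hM
  have hN0 : (0 : ℝ) < N := by exact_mod_cast Nat.pos_of_ne_zero hN
  have hN1 : (1 : ℝ) ≤ N := by exact_mod_cast Nat.pos_of_ne_zero hN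
  have hNM : (N : ℝ) = α * M := by rw [← hd, density]; field_simp
  have hnR : ∑ i, (n i : ℝ) = N := by exact_mod_cast hn
  have hKR : ∑ i, (K i : ℝ) = M := by exact_mod_cast hKM
  obtain ⟨i, hi⟩ : ∃ i, A * (N : ℝ) ^ (2 / 3 - ε) < |(n i : ℝ) - N * q i| := by
    simpa [InWindow] using hwin
  set D := A * (N : ℝ) ^ (2 / 3 - ε) with hD
  have hD0 : 0 < D := by positivity
  have hqi := hq i
  -- A bin with fraction one is the only bin and contains all particles, so it cannot deviate.
  have hqi1 : q i < 1 := by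
    by_contra hge
    have hsum := Finset.add_sum_erase Finset.univ q (Finset.mem_univ i)
    have hempty : Finset.univ.erase i = ∅ := by
      by_contra hne
      have := Finset.sum_pos (fun j _ => hq j) (Finset.nonempty_iff_ne_empty.mpr hne)
      rw [hq1] at hsum
      linarith
    have hnsum := Finset.add_sum_erase Finset.univ (fun j => (n j : ℝ)) (Finset.mem_univ i)
    simp only [hempty, Finset.sum_empty, add_zero] at hsum hnsum
    rw [hsum, hq1, hnsum, hnR, mul_one, sub_self, abs_zero] at hi
    linarith
  have hqi' : 0 < 1 - q i := by linarith
  set δ := (n i : ℝ) - N * q i with hδ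
  -- The deviation at the edge of the window, with the sign of the actual one.
  obtain ⟨d, hdD, hδd⟩ : ∃ d : ℝ, |d| = D ∧ 0 ≤ (δ - d) * d := by
    rcases lt_abs.mp hi with h | h
    · exact ⟨D, abs_of_pos hD0, mul_nonneg (by linarith) hD0.le⟩
    · exact ⟨-D, by rw [abs_neg, abs_of_pos hD0], by nlinarith⟩
  have hDN : D / N = A * (N : ℝ) ^ (-(1 / 3 + ε)) := by
    rw [hD, mul_div_assoc, ← Real.rpow_sub_one hN0.ne']
    congr 2
    ring
  have hsm := hN₁ N (le_trans (le_max_left _ _) hN') i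
  have hfrac : ∀ x : ℝ, 0 < x → 1 / x ≤ 1 / q i + 1 / (1 - q i) → ∀ c : ℝ, |c| ≤ 1 + |β| →
      ∀ e : ℝ, |e| = D → |c * (e / (x * N))| ≤ 1 / 2 := by
    intro x hx hx' c hc e he
    rw [abs_mul, abs_div, he, abs_of_pos (mul_pos hx hN0)]
    calc |c| * (D / (x * N)) = |c| * (1 / x * (D / N)) := by field_simp
      _ ≤ (1 + |β|) * ((1 / q i + 1 / (1 - q i)) * (D / N)) := by gcongr
      _ = (1 + |β|) * A * (1 / q i + 1 / (1 - q i)) * (N : ℝ) ^ (-(1 / 3 + ε)) := by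
        rw [hDN]; ring
      _ ≤ 1 / 2 := hsm
  have hx1 : 1 / q i ≤ 1 / q i + 1 / (1 - q i) := by
    have : 0 < 1 / (1 - q i) := by positivity
    linarith
  have hx2 : 1 / (1 - q i) ≤ 1 / q i + 1 / (1 - q i) := by
    have : 0 < 1 / q i := by positivity
    linarith
  have hc1 : |(1 : ℝ)| ≤ 1 + |β| := by rw [abs_one]; linarith [abs_nonneg β]
  have hc2 : |β| ≤ 1 + |β| := by linarith
  have hd' : |-d| = D := by rw [abs_neg, hdD]
  have t1 := hfrac _ hqi hx1 1 hc1 d hdD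
  have t2 := hfrac _ hqi hx1 β hc2 d hdD
  have t3 := hfrac _ hqi' hx2 1 hc1 (-d) hd'
  have t4 := hfrac _ hqi' hx2 β hc2 (-d) hd'
  rw [one_mul] at t1 t3
  -- All bins other than `i` get the same tilt, so together they act as one complementary bin of
  -- fraction `1 - q i`.
  set t : Fin r → ℝ := fun j => if j = i then d / (q i * N) else -d / ((1 - q i) * N) with ht
  have hti : t i = d / (q i * N) := if_pos rfl
  have htj : ∀ j, j ≠ i → t j = -d / ((1 - q i) * N) := fun j hj => if_neg hj
  have htcase : ∀ j, |t j| ≤ 1 / 2 ∧ |β * t j| ≤ 1 / 2 := by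
    intro j
    by_cases hj : j = i
    · rw [hj, hti]; exact ⟨t1, t2⟩
    · rw [htj j hj]; exact ⟨t3, t4⟩
  have hK0 : ∀ j, K j ≠ 0 := fun j => by
    have : (0 : ℝ) < K j := by rw [hK j]; exact mul_pos (hq j) hM0
    exact_mod_cast this.ne'
  have hP := binProb_le_exp hα hσα hM hN hd hK0 hKM hn t
    (fun j => by linarith [(abs_le.mp (htcase j).1).1])
    (fun j => by linarith [(abs_le.mp (htcase j).2).1])
  have hsum : ∑ j, ((n j : ℝ) * (Real.log (1 + β * t j) - Real.log (1 + t j)) +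
      s * K j * Real.log (1 + β * t j)) ≤
      -(1 / (1 + s * α) * (d ^ 2 / N)) + tiltConst s α (q i) * (|d| ^ 3 / (N : ℝ) ^ 2) := by
    have h := two_bin_exponent_le (δ := δ) hss hα hσα hqi hqi1 hM0 hNM t1 t2 t3 t4 hδd
    refine le_trans (le_of_eq ?_) h
    rw [← Finset.add_sum_erase Finset.univ _ (Finset.mem_univ i), hti]
    have hrest : ∑ j ∈ Finset.univ.erase i, ((n j : ℝ) * (Real.log (1 + β * t j) -
        Real.log (1 + t j)) + s * K j * Real.log (1 + β * t j)) =
        ((1 - q i) * N - δ) * (Real.log (1 + β * (-d / ((1 - q i) * N))) -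
          Real.log (1 + -d / ((1 - q i) * N))) +
        s * ((1 - q i) * M) * Real.log (1 + β * (-d / ((1 - q i) * N))) := by
      have hn' := Finset.add_sum_erase Finset.univ (fun j => (n j : ℝ)) (Finset.mem_univ i)
      have hK' := Finset.add_sum_erase Finset.univ (fun j => (K j : ℝ)) (Finset.mem_univ i)
      simp only [hnR, hKR, hK i] at hn' hK'
      have e1 : (1 - q i) * N - δ = ∑ j ∈ Finset.univ.erase i, (n j : ℝ) := by
        rw [hδ]; linarith
      have e2 : (1 - q i) * M = ∑ j ∈ Finset.univ.erase i, (K j : ℝ) := by linarith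
      rw [e1, e2, Finset.sum_mul, Finset.mul_sum, Finset.sum_mul, ← Finset.sum_add_distrib]
      refine Finset.sum_congr rfl fun j hj => ?_
      rw [htj j (Finset.ne_of_mem_erase hj)]
    rw [hrest, hK i, hδ]
    congr 2
    ring
  have hquad : d ^ 2 / (N : ℝ) = A ^ 2 * (N : ℝ) ^ (1 / 3 - 2 * ε) := by
    rw [← sq_abs, hdD, hD, mul_pow, ← Real.rpow_natCast ((N : ℝ) ^ (2 / 3 - ε)) 2,
      ← Real.rpow_mul hN0.le,
      mul_div_assoc, ← Real.rpow_sub_one hN0.ne']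
    congr 2
    push_cast
    ring
  -- At the edge of the window the cubic remainder is bounded and goes into the constant `C`.
  have hcub : |d| ^ 3 / (N : ℝ) ^ 2 ≤ A ^ 3 := by
    have e : |d| ^ 3 / (N : ℝ) ^ 2 = A ^ 3 * (N : ℝ) ^ (-(3 * ε)) := by
      rw [hdD, hD, mul_pow, ← Real.rpow_natCast ((N : ℝ) ^ (2 / 3 - ε)) 3,
        ← Real.rpow_mul hN0.le,
        mul_div_assoc, ← Real.rpow_natCast (N : ℝ) 2, ← Real.rpow_sub hN0]
      congr 2
      push_cast
      ring
    rw [e]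
    refine mul_le_of_le_one_right (by positivity) ?_
    exact Real.rpow_le_one_of_one_le_of_nonpos hN1 (by linarith)
  have hcub' : tiltConst s α (q i) * (|d| ^ 3 / (N : ℝ) ^ 2) ≤
      ∑ j, |tiltConst s α (q j)| * A ^ 3 := by
    refine le_trans ?_ (Finset.single_le_sum (f := fun j => |tiltConst s α (q j)| * A ^ 3)
      (fun j _ => by positivity) (Finset.mem_univ i))
    exact mul_le_mul (le_abs_self _) hcub (by positivity) (abs_nonneg _)
  -- The factor `√N` is obtained for both statistics; for fermions it is weakened to the stated
  -- power.
  have hpow : Real.exp (Real.log N / 2) ≤ (N : ℝ) ^ tailPower σ := by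
    rw [Real.rpow_def_of_pos hN0]
    refine Real.exp_le_exp.mpr ?_
    have hl := Real.log_nonneg hN1
    cases σ <;> simp only [tailPower] <;> linarith
  refine hP.trans ?_
  calc _ ≤ Real.exp (Real.log N / 2 + (C₀ + ∑ j, |tiltConst s α (q j)| * A ^ 3) +
        -(A ^ 2 / (1 + s * α)) * (N : ℝ) ^ (1 / 3 - 2 * ε)) := by
        refine Real.exp_le_exp.mpr ?_
        have e : 1 / (1 + s * α) * (d ^ 2 / (N : ℝ)) =
            A ^ 2 / (1 + s * α) * (N : ℝ) ^ (1 / 3 - 2 * ε) := by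
          rw [hquad]; ring
        rw [e] at hsum
        linarith
    _ = Real.exp (C₀ + ∑ j, |tiltConst s α (q j)| * A ^ 3) * (Real.exp (Real.log N / 2) *
        Real.exp (-(A ^ 2 / (1 + s * α)) * (N : ℝ) ^ (1 / 3 - 2 * ε))) := by
        rw [Real.exp_add, Real.exp_add]; ring
    _ ≤ _ := by gcongr

end Tail

/-! ### Assembly of the main theorem -/

theorem binSize_eq_mul {M r : ℕ} (hM : M ≠ 0) (b : Fin M → Fin r) {q : Fin r → ℝ}
    (hb : ∀ i, (binSize b i : ℝ) / (M : ℝ) = q i) (i : Fin r) :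
    (binSize b i : ℝ) = q i * M := by
  have hM0 : (M : ℝ) ≠ 0 := by exact_mod_cast hM
  rw [← hb i, div_mul_cancel₀ _ hM0]

theorem mainTheorem5 (σ : Statistics) :
    -- exact averages, for all numbers of ports and particles
    (∀ M N : ℕ,
      (∀ s n m : Fock σ M N,
        Integrable (fun U : Matrix.unitaryGroup (Fin M) ℂ =>
          amplitude U.1 n s * star (amplitude U.1 m s)) (haarU M) ∧
        ∫ U : Matrix.unitaryGroup (Fin M) ℂ,
            amplitude U.1 n s * star (amplitude U.1 m s) ∂(haarU M) =
          if n = m then (uniformProb σ M N : ℂ) else 0) ∧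
      (∀ n s : Fock σ M N, avgOutProb (Matrix.single n n 1) s = uniformProb σ M N) ∧
      (∀ ρ : Matrix (Fock σ M N) (Fock σ M N) ℂ, IsState ρ →
        (∀ s : Fock σ M N,
          Integrable (fun U : Matrix.unitaryGroup (Fin M) ℂ => outProb ρ U.1 s) (haarU M) ∧
          avgOutProb ρ s = ∑ n, (ρ n n).re * avgOutProb (Matrix.single n n 1) s ∧
          avgOutProb ρ s = uniformProb σ M N) ∧
        (∀ (r : ℕ) (b : Fin M → Fin r) (n : Fin r → ℕ), ∑ i, n i = N →
          Integrable (fun U : Matrix.unitaryGroup (Fin M) ℂ => binProb ρ U.1 b n) (haarU M) ∧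
          avgBinProb ρ b n = uniformProb σ M N *
            ∏ i, (∏ l ∈ Finset.range (n i), ((binSize b i : ℝ) + σ.sgn * (l : ℝ))) /
              ((n i).factorial : ℝ)))) ∧
    -- the asymptotic Gaussian law inside the window
    (∀ (r : ℕ) (q : Fin r → ℝ) (A ε B : ℝ), (∀ i, 0 < q i) → 0 < A → 0 < ε → ε < 1 / 6 →
      ∃ (C : ℝ) (N₀ : ℕ), ∀ N M : ℕ, N₀ ≤ N → N₀ ≤ M →
        0 < 1 + σ.sgn * density M N → errorOrder σ M N ε ≤ B →
        ∀ b : Fin M → Fin r, (∀ i, (binSize b i : ℝ) / (M : ℝ) = q i) →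
        ∀ ρ : Matrix (Fock σ M N) (Fock σ M N) ℂ, IsState ρ →
        ∀ n : Fin r → ℕ, ∑ i, n i = N → InWindow N q A ε n →
          |avgBinProb ρ b n - gaussianLaw σ M N q n| ≤
            C * errorOrder σ M N ε * gaussianLaw σ M N q n) ∧
    -- the tail bound outside the window, at fixed density
    (∀ (r : ℕ) (q : Fin r → ℝ) (A ε α : ℝ), (∀ i, 0 < q i) → 0 < A → 0 < ε → ε < 1 / 6 →
      0 < α → 0 < 1 + σ.sgn * α →
      ∃ (C : ℝ) (N₀ : ℕ), ∀ N M : ℕ, N₀ ≤ N → N₀ ≤ M → density M N = α →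
        ∀ b : Fin M → Fin r, (∀ i, (binSize b i : ℝ) / (M : ℝ) = q i) →
        ∀ ρ : Matrix (Fock σ M N) (Fock σ M N) ℂ, IsState ρ →
        ∀ n : Fin r → ℕ, ∑ i, n i = N → ¬ InWindow N q A ε n →
          avgBinProb ρ b n ≤
            C * ((N : ℝ) ^ tailPower σ *
              Real.exp (-(A ^ 2 / (1 + σ.sgn * α)) * (N : ℝ) ^ (1 / 3 - 2 * ε)))) := by
  refine ⟨fun M N => ⟨fun s n m => ⟨integrable_amplitude_mul_star n m s s,
    avgTransition_eq_uniformProb s n m⟩, fun n s => avgOutProb_single n s, fun ρ hρ =>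
    ⟨fun s => ⟨integrable_outProb ρ s, ?_, avgOutProb_of_isState hρ s⟩, fun r b n hn =>
      ⟨integrable_binProb ρ b n, avgBinProb_eq hρ b n hn⟩⟩⟩, ?_, ?_⟩
  · rw [avgOutProb_eq_trace, Finset.mul_sum]
    exact Finset.sum_congr rfl fun n _ => by rw [avgOutProb_single, mul_comm]
  · intro r q A ε B hq hA hε hε'
    obtain ⟨C, N₀, h⟩ := abs_binProb_sub_gaussianLaw_le σ (B := B) hq hA hε hε'
    refine ⟨C, max N₀ 1, fun N M hN hM hpos hB b hb ρ hρ n hn hwin => ?_⟩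
    have hM0 : M ≠ 0 := by have := (le_max_right N₀ 1).trans hM; omega
    rw [avgBinProb_eq hρ b n hn]
    exact h N M ((le_max_left _ _).trans hN) ((le_max_left _ _).trans hM) hpos hB _ n
      (binSize_eq_mul hM0 b hb) (sum_fraction_eq_one hM0 b hb) hn hwin
  · intro r q A ε α hq hA hε _ hα hσα
    obtain ⟨C, N₀, h⟩ := binProb_le_of_not_inWindow σ hq hA hε hα hσα
    refine ⟨C, max N₀ 1, fun N M hN hM hd b hb ρ hρ n hn hwin => ?_⟩
    have hM0 : M ≠ 0 := by have := (le_max_right N₀ 1).trans hM; omega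
    rw [avgBinProb_eq hρ b n hn]
    exact h N M ((le_max_left _ _).trans hN) ((le_max_left _ _).trans hM) hd _ n
      (binSize_eq_mul hM0 b hb) (sum_binSize b) (sum_fraction_eq_one hM0 b hb) hn hwin
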